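/- Let $d\ge 2$ be an integer and $r\in\mathbb{C}$. Let $\hat{\mathfrak h}$ be the complex Lie algebra with basis $v^i(m)$ ($1\le i\le d$, $m\in\mathbb{Z}$) and $\mathbf c$, where $\mathbf c$ is central and $[v^i(m),v^j(n)]=\delta_{m+n,0}\delta_{i,j}\,m\,\mathbf c$. In $U(\hat{\mathfrak h})/\langle \mathbf c-1\rangle$ let $v^{ij}(m,n)$ be the class of $v^i(m)v^j(n)$, let $$\mathcal B=\{v^{ii}(m,n)\mid 1\le i\le d,\ m\le n\}\cup\{v^{ij}(m,n)\mid 1\le i<j\le d,\ m,n\in\mathbb{Z}\},$$ and let $\mathcal L=(\operatorname{Span}_{\mathbb C}\mathcal B)\oplus\mathbb{C}$, with projections $\pi_1$ onto $\operatorname{Span}_{\mathbb C}\mathcal B$ and $\pi_2$ onto $\mathbb{C}$. Let $\mathcal L_r$ be the Lie algebra $\mathcal L$ with the bracket $[x,y]_r=\pi_1(xy-yx)+r\,\pi_2(xy-yx)$. Let $\mathcal B_+$ be the set of those $v^{ij}(m,n)\in\mathcal B$ with $m\ge 0$ or $n\ge 0$, let $\mathcal L_r^+=(\operatorname{Span}_{\mathbb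 C}\mathcal B_+)\oplus\mathbb{C}$, which is a Lie subalgebra of $\mathcal L_r$, and let $\mathbb{C}\mathbf 1$ be the one-dimensional $\mathcal L_r^+$-module on which $\mathcal B_+$ acts by $0$ and each $s\in\mathbb{C}\subset\mathcal L_r^+$ acts by $s$. Put $M_r=U(\mathcal L_r)\otimes_{U(\mathcal L_r^+)}\mathbb{C}\mathbf 1$. Let $\mathcal L_r^{(1)}$ be the Lie subalgebra of $\mathcal L_r$ generated by the $v^{11}(m,n)$ with $m\le n$, and let $M_r^{(1)}=U(\mathcal L_r^{(1)})\mathbf 1\subset M_r$. A module is called reducible if it has a submodule that is neither zero nor the whole module. The maximal proper submodule of a module means a proper submodule that contains every proper submodule. **Proposition 4.6.** The $\mathcal L_r$-module $M_r$ is reducible if and only if the $\mathcal L_r^{(1)}$-module $M_r^{(1)}$ is reducible. Assume that this is the case. Then $M_r^{(1)}$ has a maximal proper $\mathcal L_r^{(1)}$-submodule, $M_r$ has a maximal proper $\mathcal L_r$-submodule, and the following hold. 1. If $W_1$ is the maximal proper $\mathcal L_r^{(1)}$-submodule of $M_r^{(1)}$, then $U(\mathcal L_r)W_1$ is the maximal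 proper $\mathcal L_r$-submodule of $M_r$. 2. If $W_2$ is the maximal proper $\mathcal L_r$-submodule of $M_r$, then $W_2\cap M_r^{(1)}$ is the maximal proper $\mathcal L_r^{(1)}$-submodule of $M_r^{(1)}$. -/

import Mathlib

noncomputable section

namespace JordanVOA

open scoped TensorProduct

attribute [local instance] LieRing.ofAssociativeRing

/-! ### The Heisenberg Lie algebra -/

/-- The vector space with basis `v^i(m)` (`i` in `Fin d`, `m : ℤ`) together with `c`. -/
def Heis (d : ℕ) : Type := ((Fin d × ℤ) →₀ ℂ) × ℂ

instance (d : ℕ) : AddCommGroup (Heis d) :=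
  inferInstanceAs (AddCommGroup (((Fin d × ℤ) →₀ ℂ) × ℂ))

instance (d : ℕ) : Module ℂ (Heis d) :=
  inferInstanceAs (Module ℂ (((Fin d × ℤ) →₀ ℂ) × ℂ))

/-- The basis vector `v^i(m)`. -/
def hv {d : ℕ} (i : Fin d) (m : ℤ) : Heis d := (Finsupp.single (i, m) 1, 0)

/-- The central basis vector `c`. -/
def hc (d : ℕ) : Heis d := (0, 1)

/-- The bilinear form with value `δ_{m+n,0} δ_{i,j} m` on the pair `(v^i(m), v^j(n))`. -/
def heisForm (d : ℕ) : ((Fin d × ℤ) →₀ ℂ) →ₗ[ℂ] ((Fin d × ℤ) →₀ ℂ) →ₗ[ℂ] ℂ :=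
  Finsupp.linearCombination ℂ fun p => (p.2 : ℂ) • Finsupp.lapply (p.1, -p.2)

theorem heisForm_single {d : ℕ} (i j : Fin d) (m n : ℤ) :
    heisForm d (Finsupp.single (i, m) 1) (Finsupp.single (j, n) 1) =
      if m + n = 0 ∧ i = j then (m : ℂ) else 0 := by
  have h : ((j, n) = (i, -m)) ↔ (m + n = 0 ∧ i = j) := by
    rw [Prod.mk.injEq]
    constructor
    · rintro ⟨rfl, rfl⟩; simp
    · rintro ⟨h, rfl⟩; exact ⟨rfl, by omega⟩
  simp [heisForm, Finsupp.single_apply, h]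

theorem heisForm_swap {d : ℕ} (a b : (Fin d × ℤ) →₀ ℂ) :
    heisForm d a b = - heisForm d b a := by
  have : heisForm d = - (heisForm d).flip := by
    ext ⟨i, m⟩ ⟨j, n⟩
    simp only [LinearMap.comp_apply, Finsupp.lsingle_apply, LinearMap.neg_apply,
      LinearMap.flip_apply, heisForm_single]
    by_cases h : m + n = 0 ∧ i = j
    · have h' : n + m = 0 ∧ j = i := ⟨by omega, h.2.symm⟩
      rw [if_pos h, if_pos h']
      have : m = -n := by omega
      rw [this]; push_cast; ring
    · have h' : ¬ (n + m = 0 ∧ j = i) := fun k => h ⟨by omega, k.2.symm⟩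
      rw [if_neg h, if_neg h']; simp
  exact congrArg (fun f => f a b) this

theorem heisForm_self {d : ℕ} (a : (Fin d × ℤ) →₀ ℂ) : heisForm d a a = 0 :=
  self_eq_neg.mp (heisForm_swap a a)

/-- The Lie bracket `[v^i(m), v^j(n)] = δ_{m+n,0} δ_{i,j} m c`, with `c` central. -/
instance (d : ℕ) : LieRing (Heis d) where
  bracket x y := (0, heisForm d x.1 y.1)
  add_lie x y z := Prod.ext (add_zero _).symm (by
    change heisForm d (x.1 + y.1) z.1 = heisForm d x.1 z.1 + heisForm d y.1 z.1
    simp)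
  lie_add x y z := Prod.ext (add_zero _).symm (by
    change heisForm d x.1 (y.1 + z.1) = heisForm d x.1 y.1 + heisForm d x.1 z.1
    simp)
  lie_self x := Prod.ext rfl (heisForm_self x.1)
  leibniz_lie x y z := Prod.ext (add_zero _).symm (by
    change heisForm d x.1 0 = heisForm d 0 z.1 + heisForm d y.1 0
    simp)

instance (d : ℕ) : LieAlgebra ℂ (Heis d) where
  lie_smul t x y := Prod.ext (smul_zero t).symm (by
    change heisForm d x.1 (t • y.1) = t • heisForm d x.1 y.1
    simp)

theorem heis_lie {d : ℕ} (x y : Heis d) : ⁅x, y⁆ = heisForm d x.1 y.1 • hc d := by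
  refine Prod.ext ?_ ?_
  · change (0 : (Fin d × ℤ) →₀ ℂ) = heisForm d x.1 y.1 • (0 : (Fin d × ℤ) →₀ ℂ)
    simp
  · change heisForm d x.1 y.1 = heisForm d x.1 y.1 • (1 : ℂ)
    simp

/-! ### The quotient of the enveloping algebra by `c - 1`, and the quadratic elements -/

/-- The quotient of the enveloping algebra of `Heis d` by the two-sided ideal generated
by `c - 1`. -/
abbrev Weyl (d : ℕ) : Type :=
  RingQuot (fun a b : UniversalEnvelopingAlgebra ℂ (Heis d) =>
    a = UniversalEnvelopingAlgebra.ι ℂ (hc d) ∧ b = 1)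

/-- The canonical map from the Heisenberg Lie algebra to the quotient. -/
def toWeyl (d : ℕ) : Heis d →ₗ[ℂ] Weyl d :=
  (RingQuot.mkAlgHom ℂ _).toLinearMap ∘ₗ
    (UniversalEnvelopingAlgebra.ι ℂ : Heis d →ₗ⁅ℂ⁆ _).toLinearMap

/-- The class of `v^i(m) v^j(n)`, written `v^{ij}(m,n)`. -/
def vv {d : ℕ} (i j : Fin d) (m n : ℤ) : Weyl d := toWeyl d (hv i m) * toWeyl d (hv j n)

/-- The set `B` of the `v^{ii}(m,n)` with `m ≤ n` and the `v^{ij}(m,n)` with `i < j`. -/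
def setB (d : ℕ) : Set (Weyl d) :=
  {x | ∃ i m n, m ≤ n ∧ x = vv i i m n} ∪ {x | ∃ i j m n, i < j ∧ x = vv i j m n}

/-- The set `B₊` of the elements `v^{ij}(m,n)` of `B` with `m ≥ 0` or `n ≥ 0`. -/
def setBplus (d : ℕ) : Set (Weyl d) :=
  {x | ∃ i m n, m ≤ n ∧ (0 ≤ m ∨ 0 ≤ n) ∧ x = vv i i m n} ∪
    {x | ∃ i j m n, i < j ∧ (0 ≤ m ∨ 0 ≤ n) ∧ x = vv i j m n}

/-- The space `Span B ⊕ ℂ`; the sum is direct by `disjoint_span_setB` below. -/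
def calL (d : ℕ) : Submodule ℂ (Weyl d) :=
  Submodule.span ℂ (setB d) ⊔ Submodule.span ℂ {1}

theorem toWeyl_comm {d : ℕ} (x y : Heis d) :
    toWeyl d x * toWeyl d y = toWeyl d y * toWeyl d x + heisForm d x.1 y.1 • 1 := by
  have hc1 : RingQuot.mkAlgHom ℂ (fun a b : UniversalEnvelopingAlgebra ℂ (Heis d) =>
      a = UniversalEnvelopingAlgebra.ι ℂ (hc d) ∧ b = 1)
      (UniversalEnvelopingAlgebra.ι ℂ (hc d)) = 1 := by
    rw [RingQuot.mkAlgHom_rel ℂ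
      (s := fun a b : UniversalEnvelopingAlgebra ℂ (Heis d) =>
        a = UniversalEnvelopingAlgebra.ι ℂ (hc d) ∧ b = 1) ⟨rfl, rfl⟩, map_one]
  have h := LieHom.map_lie (UniversalEnvelopingAlgebra.ι ℂ : Heis d →ₗ⁅ℂ⁆ _) x y
  rw [heis_lie, LieRing.of_associative_ring_bracket, map_smul] at h
  have h2 := congrArg (RingQuot.mkAlgHom ℂ
    (fun a b : UniversalEnvelopingAlgebra ℂ (Heis d) =>
      a = UniversalEnvelopingAlgebra.ι ℂ (hc d) ∧ b = 1)) h
  rw [map_smul, hc1, map_sub, map_mul, map_mul] at h2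
  change _ = toWeyl d x * toWeyl d y - toWeyl d y * toWeyl d x at h2
  rw [h2]; abel

theorem hv_comm {d : ℕ} (i j : Fin d) (m n : ℤ) :
    toWeyl d (hv i m) * toWeyl d (hv j n) = toWeyl d (hv j n) * toWeyl d (hv i m) +
      (if m + n = 0 ∧ i = j then (m : ℂ) else 0) • 1 := by
  rw [toWeyl_comm]
  congr 2
  exact heisForm_single i j m n

theorem one_mem_calL (d : ℕ) : (1 : Weyl d) ∈ calL d :=
  Submodule.mem_sup_right (Submodule.subset_span rfl)

theorem vv_mem_calL {d : ℕ} (i j : Fin d) (m n : ℤ) : vv i j m n ∈ calL d := by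
  have key : vv i j m n = vv j i n m + (if m + n = 0 ∧ i = j then (m : ℂ) else 0) • 1 :=
    hv_comm i j m n
  have hB : ∀ x ∈ setB d, x ∈ calL d := fun x hx =>
    Submodule.mem_sup_left (Submodule.subset_span hx)
  rcases lt_trichotomy i j with h | rfl | h
  · exact hB _ (Or.inr ⟨i, j, m, n, h, rfl⟩)
  · rcases le_total m n with h | h
    · exact hB _ (Or.inl ⟨i, m, n, h, rfl⟩)
    · rw [key]
      exact add_mem (hB _ (Or.inl ⟨i, n, m, h, rfl⟩))
        (Submodule.smul_mem _ _ (one_mem_calL d))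
  · rw [key]
    exact add_mem (hB _ (Or.inr ⟨j, i, n, m, h, rfl⟩))
      (Submodule.smul_mem _ _ (one_mem_calL d))

/-- The commutator of two products of two basis vectors. -/
theorem vv_comm {d : ℕ} (i j k l : Fin d) (m n p q : ℤ) :
    vv i j m n * vv k l p q - vv k l p q * vv i j m n =
      (if n + p = 0 ∧ j = k then (n : ℂ) else 0) • vv i l m q +
      (if m + p = 0 ∧ i = k then (m : ℂ) else 0) • vv j l n q +
      (if n + q = 0 ∧ j = l then (n : ℂ) else 0) • vv k i p m +
      (if m + q = 0 ∧ i = l then (m : ℂ) else 0) • vv k j p n := by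
  have h1 := hv_comm j k n p
  have h2 := hv_comm i k m p
  have h3 := hv_comm j l n q
  have h4 := hv_comm i l m q
  simp only [vv]
  generalize (if n + p = 0 ∧ j = k then (n : ℂ) else 0) = s1 at *
  generalize (if m + p = 0 ∧ i = k then (m : ℂ) else 0) = s2 at *
  generalize (if n + q = 0 ∧ j = l then (n : ℂ) else 0) = s3 at *
  generalize (if m + q = 0 ∧ i = l then (m : ℂ) else 0) = s4 at *
  generalize toWeyl d (hv i m) = a at *
  generalize toWeyl d (hv j n) = b at *
  generalize toWeyl d (hv k p) = c at *
  generalize toWeyl d (hv l q) = e at *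
  have e1 : a * b * (c * e) = a * (b * c) * e := by noncomm_ring
  have e2 : a * (c * b + s1 • 1) * e = (a * c) * (b * e) + s1 • (a * e) := by
    simp only [mul_add, add_mul, mul_smul_comm, smul_mul_assoc, mul_one]
    noncomm_ring
  have e3 : (c * a + s2 • 1) * (e * b + s3 • 1) =
      c * (a * e) * b + s2 • (e * b + s3 • 1) + s3 • (c * a) := by
    simp only [mul_add, add_mul, mul_smul_comm, smul_mul_assoc, mul_one, one_mul, smul_add,
      smul_comm s3 s2]
    noncomm_ring
  have e4 : c * (e * a + s4 • 1) * b = c * e * (a * b) + s4 • (c * b) := by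
    simp only [mul_add, add_mul, mul_smul_comm, smul_mul_assoc, mul_one]
    noncomm_ring
  rw [e1, h1, e2, h2]
  nth_rewrite 1 [h3]
  rw [e3, ← h3, h4, e4]
  abel

/-! ### Directness of the sum, by the action on polynomials -/

/-- `v^i(m)` acts on polynomials by multiplication by a variable if `m < 0`, and by `m` times
a partial derivative if `m ≥ 0`. -/
def fockOp {d : ℕ} (p : Fin d × ℤ) : Module.End ℂ (MvPolynomial (Fin d × ℤ) ℂ) :=
  if p.2 < 0 then LinearMap.mulLeft ℂ (MvPolynomial.X p)
  else (p.2 : ℂ) • (MvPolynomial.pderiv (p.1, -p.2)).toLinearMap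

theorem pderiv_comm {σ : Type} (a b : σ) (f : MvPolynomial σ ℂ) :
    MvPolynomial.pderiv a (MvPolynomial.pderiv b f) =
      MvPolynomial.pderiv b (MvPolynomial.pderiv a f) := by
  classical
  have h : ⁅MvPolynomial.pderiv (R := ℂ) a, MvPolynomial.pderiv (R := ℂ) b⁆ = 0 := by
    refine MvPolynomial.derivation_ext fun c => ?_
    rw [Derivation.commutator_apply, MvPolynomial.pderiv_X, MvPolynomial.pderiv_X]
    simp [Pi.single_apply, apply_ite]
  have h2 := congrArg (fun D => D f) h
  simp only [Derivation.commutator_apply, Derivation.zero_apply] at h2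
  exact sub_eq_zero.mp h2

theorem fockOp_comm {d : ℕ} (p q : Fin d × ℤ) :
    fockOp p * fockOp q - fockOp q * fockOp p =
      heisForm d (Finsupp.single p 1) (Finsupp.single q 1) • 1 := by
  obtain ⟨i, m⟩ := p
  obtain ⟨j, n⟩ := q
  rw [heisForm_single]
  refine LinearMap.ext fun f => ?_
  simp only [fockOp]
  by_cases hm : m < 0 <;> by_cases hn : n < 0
  · have h0 : ¬ (m + n = 0 ∧ i = j) := by omega
    rw [if_neg h0]
    simp only [hm, hn, if_true]
    simp only [LinearMap.sub_apply, Module.End.mul_apply, LinearMap.mulLeft_apply, zero_smul,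
      LinearMap.zero_apply]
    ring
  · simp only [hm, hn, if_true, if_false]
    simp only [LinearMap.sub_apply, Module.End.mul_apply, LinearMap.mulLeft_apply,
      LinearMap.smul_apply, Derivation.coeFn_coe,
      Derivation.leibniz, MvPolynomial.pderiv_X, Module.End.one_apply, smul_eq_mul]
    by_cases h : m + n = 0 ∧ i = j
    · obtain ⟨h, rfl⟩ := h
      have : m = -n := by omega
      subst this
      simp [Algebra.smul_def]
      ring
    · have h' : ¬ ((i, m) = (j, -n)) := fun k => h (by
        rw [Prod.mk.injEq] at k; exact ⟨by omega, k.1⟩)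
      rw [Pi.single_eq_of_ne h']
      simp [h]
  · simp only [hm, hn, if_true, if_false]
    simp only [LinearMap.sub_apply, Module.End.mul_apply, LinearMap.mulLeft_apply,
      LinearMap.smul_apply, Derivation.coeFn_coe,
      Derivation.leibniz, MvPolynomial.pderiv_X, Module.End.one_apply, smul_eq_mul]
    by_cases h : m + n = 0 ∧ i = j
    · obtain ⟨h, rfl⟩ := h
      have : n = -m := by omega
      subst this
      simp [Algebra.smul_def]
      ring
    · have h' : ¬ ((j, n) = (i, -m)) := fun k => h (by
        rw [Prod.mk.injEq] at k; exact ⟨by omega, k.1.symm⟩)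
      rw [Pi.single_eq_of_ne h']
      simp [h]
  · have h0 : (if m + n = 0 ∧ i = j then (m : ℂ) else 0) = 0 := by
      split_ifs with h
      · have : m = 0 := by omega
        simp [this]
      · rfl
    rw [h0]
    simp only [hm, hn, if_false]
    simp only [LinearMap.sub_apply, Module.End.mul_apply,
      LinearMap.smul_apply, Derivation.coeFn_coe,
      Derivation.map_smul, zero_smul]
    rw [smul_comm, pderiv_comm, sub_self]
    rfl

/-- The operators `fockOp`, extended linearly. -/
def fockLin (d : ℕ) : ((Fin d × ℤ) →₀ ℂ) →ₗ[ℂ] Module.End ℂ (MvPolynomial (Fin d × ℤ) ℂ) :=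
  Finsupp.linearCombination ℂ fockOp

theorem fockLin_comm {d : ℕ} (a b : (Fin d × ℤ) →₀ ℂ) :
    fockLin d a * fockLin d b - fockLin d b * fockLin d a = heisForm d a b • 1 := by
  induction a using Finsupp.induction_linear with
  | zero => simp
  | add a₁ a₂ h₁ h₂ =>
    simp only [map_add, add_mul, mul_add, LinearMap.add_apply, add_smul]
    rw [← h₁, ← h₂]; abel
  | single p s =>
    induction b using Finsupp.induction_linear with
    | zero => simp
    | add b₁ b₂ h₁ h₂ =>
      simp only [map_add, add_mul, mul_add, add_smul]
      rw [← h₁, ← h₂]; abel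
    | single q t =>
      have hs : Finsupp.single p s = s • Finsupp.single p (1 : ℂ) := by simp
      have ht : Finsupp.single q t = t • Finsupp.single q (1 : ℂ) := by simp
      have e : ∀ p : Fin d × ℤ, fockLin d (Finsupp.single p 1) = fockOp p := fun p => by
        simp [fockLin]
      rw [hs, ht]
      simp only [map_smul, LinearMap.smul_apply, e, smul_mul_smul_comm]
      rw [mul_comm t s, ← smul_sub (s * t) (fockOp p * fockOp q) (fockOp q * fockOp p),
        fockOp_comm, smul_smul, smul_eq_mul, smul_eq_mul]
      congr 1
      ring

/-- The action of the Heisenberg Lie algebra on polynomials, with `c` acting as `1`. -/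
def fockRep (d : ℕ) : Heis d →ₗ⁅ℂ⁆ Module.End ℂ (MvPolynomial (Fin d × ℤ) ℂ) where
  toFun x := fockLin d x.1 + x.2 • 1
  map_add' x y := by
    change fockLin d (x.1 + y.1) + (x.2 + y.2) • 1 = _
    rw [map_add, add_smul]; abel
  map_smul' t x := by
    change fockLin d (t • x.1) + (t * x.2) • 1 = t • (fockLin d x.1 + x.2 • 1)
    rw [map_smul, smul_add, smul_smul]
  map_lie' {x y} := by
    change fockLin d 0 + heisForm d x.1 y.1 • 1 = _
    rw [← fockLin_comm, LieRing.of_associative_ring_bracket]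
    simp only [mul_add, add_mul, mul_smul_comm, smul_mul_assoc, mul_one, one_mul, map_zero,
      smul_add]
    rw [smul_comm x.2 y.2]
    abel

/-- The action of the quotient algebra on polynomials. -/
def weylRep (d : ℕ) : Weyl d →ₐ[ℂ] Module.End ℂ (MvPolynomial (Fin d × ℤ) ℂ) :=
  RingQuot.liftAlgHom ℂ ⟨UniversalEnvelopingAlgebra.lift ℂ (fockRep d), by
    rintro _ _ ⟨rfl, rfl⟩
    rw [UniversalEnvelopingAlgebra.lift_ι_apply, map_one]
    change fockLin d 0 + (1 : ℂ) • 1 = 1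
    rw [map_zero, zero_add, one_smul]⟩

theorem weylRep_hv {d : ℕ} (i : Fin d) (m : ℤ) :
    weylRep d (toWeyl d (hv i m)) = fockOp (i, m) := by
  change weylRep d (RingQuot.mkAlgHom ℂ _ (UniversalEnvelopingAlgebra.ι ℂ (hv i m))) = _
  rw [weylRep, RingQuot.liftAlgHom_mkAlgHom_apply, UniversalEnvelopingAlgebra.lift_ι_apply]
  change fockLin d (Finsupp.single (i, m) 1) + (0 : ℂ) • 1 = _
  simp [fockLin]

/-- The vacuum expectation value: the constant coefficient of the image of `1`. -/
def vacExp (d : ℕ) : Weyl d →ₗ[ℂ] ℂ :=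
  (MvPolynomial.aeval (fun _ => (0 : ℂ))).toLinearMap ∘ₗ
    LinearMap.applyₗ (1 : MvPolynomial (Fin d × ℤ) ℂ) ∘ₗ (weylRep d).toLinearMap

theorem vacExp_apply {d : ℕ} (x : Weyl d) :
    vacExp d x = MvPolynomial.aeval (fun _ => (0 : ℂ)) (weylRep d x 1) := rfl

theorem vacExp_one (d : ℕ) : vacExp d 1 = 1 := by
  simp [vacExp_apply]

theorem fockOp_one {d : ℕ} (p : Fin d × ℤ) (h : 0 ≤ p.2) : fockOp p 1 = 0 := by
  rw [fockOp, if_neg (by omega)]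
  simp

/-- A product `v^i(m) v^j(n)` with `n ≥ 0` annihilates the constant polynomials. -/
theorem vv_one_of_nonneg {d : ℕ} (i j : Fin d) (m n : ℤ) (h : 0 ≤ n) :
    weylRep d (vv i j m n) 1 = 0 := by
  rw [vv, map_mul, weylRep_hv, weylRep_hv, Module.End.mul_apply, fockOp_one _ h, map_zero]

theorem vv_one_of_ne {d : ℕ} (i j : Fin d) (m n : ℤ) (h : i ≠ j) (h' : 0 ≤ m ∨ 0 ≤ n) :
    weylRep d (vv i j m n) 1 = 0 := by
  rcases h' with h' | h'
  · have : vv i j m n = vv j i n m := by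
      have := hv_comm i j m n
      rw [if_neg (fun k => h k.2), zero_smul, add_zero] at this
      exact this
    rw [this]
    exact vv_one_of_nonneg _ _ _ _ h'
  · exact vv_one_of_nonneg _ _ _ _ h'

theorem setBplus_one {d : ℕ} {x : Weyl d} (hx : x ∈ setBplus d) : weylRep d x 1 = 0 := by
  rcases hx with ⟨i, m, n, h, h', rfl⟩ | ⟨i, j, m, n, h, h', rfl⟩
  · exact vv_one_of_nonneg _ _ _ _ (by omega)
  · exact vv_one_of_ne _ _ _ _ h.ne h'

theorem vacExp_setB {d : ℕ} {x : Weyl d} (hx : x ∈ setB d) : vacExp d x = 0 := by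
  have key : ∀ (i j : Fin d) (m n : ℤ), m < 0 → vacExp d (vv i j m n) = 0 := by
    intro i j m n hm
    rw [vacExp_apply, vv, map_mul, weylRep_hv, Module.End.mul_apply, fockOp, if_pos hm,
      LinearMap.mulLeft_apply, map_mul, MvPolynomial.aeval_X, zero_mul]
  by_cases hp : x ∈ setBplus d
  · rw [vacExp_apply, setBplus_one hp, map_zero]
  · rcases hx with ⟨i, m, n, h, rfl⟩ | ⟨i, j, m, n, h, rfl⟩
    · refine key _ _ _ _ (not_le.mp fun hm => hp (Or.inl ⟨i, m, n, h, Or.inl hm, rfl⟩))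
    · refine key _ _ _ _ (not_le.mp fun hm => hp (Or.inr ⟨i, j, m, n, h, Or.inl hm, rfl⟩))

theorem vacExp_span {d : ℕ} {x : Weyl d} (hx : x ∈ Submodule.span ℂ (setB d)) :
    vacExp d x = 0 :=
  (Submodule.span_le (p := LinearMap.ker (vacExp d))).mpr (fun _ h => vacExp_setB h) hx

theorem disjoint_span_setB (d : ℕ) :
    Disjoint (Submodule.span ℂ (setB d)) (Submodule.span ℂ {(1 : Weyl d)}) := by
  rw [Submodule.disjoint_def]
  intro x hx h1
  obtain ⟨s, rfl⟩ := Submodule.mem_span_singleton.mp h1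
  have := vacExp_span hx
  rw [map_smul, vacExp_one, smul_eq_mul, mul_one] at this
  rw [this, zero_smul]

/-! ### The Lie algebra `𝓛_r` -/

/-- The summand `Span B` of `calL d`. -/
def spanB (d : ℕ) : Submodule ℂ (calL d) := (Submodule.span ℂ (setB d)).comap (calL d).subtype

/-- The summand `ℂ` of `calL d`. -/
def scalars (d : ℕ) : Submodule ℂ (calL d) := (Submodule.span ℂ {1}).comap (calL d).subtype

theorem isCompl_spanB (d : ℕ) : IsCompl (spanB d) (scalars d) := by
  constructor
  · rw [Submodule.disjoint_def]
    intro x hx h1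
    exact Subtype.ext ((Submodule.disjoint_def.mp (disjoint_span_setB d)) x.1 hx h1)
  · rw [codisjoint_iff, eq_top_iff]
    rintro ⟨x, hx⟩ -
    obtain ⟨y, hy, z, hz, rfl⟩ := Submodule.mem_sup.mp hx
    exact Submodule.mem_sup.mpr ⟨⟨y, Submodule.mem_sup_left hy⟩, hy,
      ⟨z, Submodule.mem_sup_right hz⟩, hz, rfl⟩

/-- The projection of `calL d` onto `Span B` along `ℂ`. -/
def pi1 (d : ℕ) : calL d →ₗ[ℂ] calL d := (spanB d).projection (scalars d) (isCompl_spanB d)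

/-- The projection of `calL d` onto `ℂ` along `Span B`. -/
def pi2 (d : ℕ) : calL d →ₗ[ℂ] calL d := (scalars d).projection (spanB d) (isCompl_spanB d).symm

theorem pi_add {d : ℕ} (x : calL d) : pi1 d x + pi2 d x = x :=
  Submodule.projection_add_projection_eq_self (isCompl_spanB d) x

theorem pi2_coe {d : ℕ} (x : calL d) : (pi2 d x : Weyl d) = vacExp d x • 1 := by
  obtain ⟨s, hs⟩ := Submodule.mem_span_singleton.mp
    (show pi2 d x ∈ scalars d from Submodule.projection_apply_mem (isCompl_spanB d).symm x)
  rw [Submodule.subtype_apply] at hs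
  have h1 : vacExp d (pi1 d x : calL d) = 0 :=
    vacExp_span (Submodule.projection_apply_mem (isCompl_spanB d) x)
  have h2 : vacExp d x = s := by
    conv_lhs => rw [← pi_add x]
    rw [Submodule.coe_add, map_add, h1, ← hs, map_smul, vacExp_one, zero_add, smul_eq_mul,
      mul_one]
  rw [h2, hs]

theorem commutator_mem {d : ℕ} {x y : Weyl d} (hx : x ∈ calL d) (hy : y ∈ calL d) :
    x * y - y * x ∈ calL d := by
  have hB : ∀ z ∈ setB d, ∃ i j m n, z = vv i j m n := by
    rintro z (⟨i, m, n, -, rfl⟩ | ⟨i, j, m, n, -, rfl⟩)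
    exacts [⟨_, _, _, _, rfl⟩, ⟨_, _, _, _, rfl⟩]
  rw [calL, ← Submodule.span_union] at hx hy
  induction hx using Submodule.span_induction with
  | zero => simp
  | add a b _ _ ha hb =>
    rw [show (a + b) * y - y * (a + b) = (a * y - y * a) + (b * y - y * b) by noncomm_ring]
    exact add_mem ha hb
  | smul t a _ ha =>
    rw [smul_mul_assoc, mul_smul_comm, ← smul_sub]
    exact Submodule.smul_mem _ _ ha
  | mem a ha =>
    induction hy using Submodule.span_induction with
    | zero => simp
    | add b c _ _ hb hc =>
      rw [show a * (b + c) - (b + c) * a = (a * b - b * a) + (a * c - c * a) by noncomm_ring]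
      exact add_mem hb hc
    | smul t b _ hb =>
      rw [smul_mul_assoc, mul_smul_comm, ← smul_sub]
      exact Submodule.smul_mem _ _ hb
    | mem b hb =>
      rcases ha with ha | rfl
      · rcases hb with hb | rfl
        · obtain ⟨i, j, m, n, rfl⟩ := hB a ha
          obtain ⟨k, l, p, q, rfl⟩ := hB b hb
          rw [vv_comm]
          exact add_mem (add_mem (add_mem
            (Submodule.smul_mem _ _ (vv_mem_calL _ _ _ _))
            (Submodule.smul_mem _ _ (vv_mem_calL _ _ _ _)))
            (Submodule.smul_mem _ _ (vv_mem_calL _ _ _ _)))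
            (Submodule.smul_mem _ _ (vv_mem_calL _ _ _ _))
        · simp
      · simp

/-- The commutator of the associative algebra, restricted to `calL d`. -/
def comm {d : ℕ} (x y : calL d) : calL d := ⟨x.1 * y.1 - y.1 * x.1, commutator_mem x.2 y.2⟩

/-- The linear map `π₁ + r π₂`. -/
def twist (d : ℕ) (r : ℂ) : calL d →ₗ[ℂ] calL d := pi1 d + r • pi2 d

theorem twist_coe {d : ℕ} (r : ℂ) (x : calL d) :
    (twist d r x : Weyl d) = x + ((r - 1) * vacExp d x) • 1 := by
  have h : twist d r x = x + (r - 1) • pi2 d x := by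
    conv_rhs => rw [← pi_add x]
    rw [map_add]
    have e1 : pi2 d (pi1 d x) = 0 := Submodule.projection_apply_of_mem_right _
      (Submodule.projection_apply_mem (isCompl_spanB d) x)
    have e2 : pi2 d (pi2 d x) = pi2 d x := Submodule.projection_apply_of_mem_left _
      (Submodule.projection_apply_mem _ x)
    rw [e1, e2, twist, LinearMap.add_apply, LinearMap.smul_apply]
    module
  rw [h, Submodule.coe_add, Submodule.coe_smul, pi2_coe, smul_smul]

theorem comm_twist_left {d : ℕ} (r : ℂ) (x y : calL d) : comm (twist d r x) y = comm x y := by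
  refine Subtype.ext ?_
  simp only [comm, twist_coe, add_mul, mul_add, smul_mul_assoc, mul_smul_comm, one_mul, mul_one]
  abel

theorem comm_twist_right {d : ℕ} (r : ℂ) (x y : calL d) : comm x (twist d r y) = comm x y := by
  refine Subtype.ext ?_
  simp only [comm, twist_coe, add_mul, mul_add, smul_mul_assoc, mul_smul_comm, one_mul, mul_one]
  abel

theorem twist_add_left {d : ℕ} (r : ℂ) (x y z : calL d) :
    twist d r (comm (x + y) z) = twist d r (comm x z) + twist d r (comm y z) := by
  rw [← map_add]
  refine congrArg _ (Subtype.ext ?_)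
  simp only [comm, Submodule.coe_add]
  noncomm_ring

theorem twist_add_right {d : ℕ} (r : ℂ) (x y z : calL d) :
    twist d r (comm x (y + z)) = twist d r (comm x y) + twist d r (comm x z) := by
  rw [← map_add]
  refine congrArg _ (Subtype.ext ?_)
  simp only [comm, Submodule.coe_add]
  noncomm_ring

theorem twist_self {d : ℕ} (r : ℂ) (x : calL d) : twist d r (comm x x) = 0 := by
  have : comm x x = 0 := Subtype.ext (sub_self _)
  rw [this, map_zero]

theorem twist_smul_right {d : ℕ} (r t : ℂ) (x y : calL d) :
    twist d r (comm x (t • y)) = t • twist d r (comm x y) := by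
  rw [← map_smul]
  refine congrArg _ (Subtype.ext ?_)
  simp only [comm, Submodule.coe_smul, mul_smul_comm, smul_mul_assoc, smul_sub]

theorem twist_jacobi {d : ℕ} (r : ℂ) (x y z : calL d) :
    twist d r (comm x (twist d r (comm y z))) =
      twist d r (comm (twist d r (comm x y)) z) + twist d r (comm y (twist d r (comm x z))) := by
  rw [comm_twist_right, comm_twist_right, comm_twist_left, ← map_add]
  refine congrArg _ (Subtype.ext ?_)
  simp only [comm, Submodule.coe_add]
  noncomm_ring

/-- The Lie algebra `𝓛_r`: the space `calL d = Span B ⊕ ℂ` with the bracket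
`[x, y]_r = π₁([x, y]) + r π₂([x, y])`. -/
def Lr (d : ℕ) (_r : ℂ) : Type := calL d

instance (d : ℕ) (r : ℂ) : AddCommGroup (Lr d r) := inferInstanceAs (AddCommGroup (calL d))

instance (d : ℕ) (r : ℂ) : Module ℂ (Lr d r) := inferInstanceAs (Module ℂ (calL d))

/-- The underlying element of the associative algebra. -/
def Lr.toAlg {d : ℕ} {r : ℂ} : Lr d r →ₗ[ℂ] Weyl d := (calL d).subtype

instance (d : ℕ) (r : ℂ) : LieRing (Lr d r) where
  bracket x y := twist d r (comm x y)
  add_lie := twist_add_left r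
  lie_add := twist_add_right r
  lie_self := twist_self r
  leibniz_lie := twist_jacobi r

instance (d : ℕ) (r : ℂ) : LieAlgebra ℂ (Lr d r) where
  lie_smul := twist_smul_right r

/-- The bracket of `𝓛_r`, in terms of the projections. -/
theorem Lr_lie {d : ℕ} {r : ℂ} (x y : Lr d r) :
    ⁅x, y⁆ = (pi1 d (comm x y) + r • pi2 d (comm x y) : calL d) := rfl

theorem Lr_lie_toAlg {d : ℕ} {r : ℂ} (x y : Lr d r) :
    Lr.toAlg ⁅x, y⁆ = (Lr.toAlg x * Lr.toAlg y - Lr.toAlg y * Lr.toAlg x) +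
      ((r - 1) * vacExp d (Lr.toAlg x * Lr.toAlg y - Lr.toAlg y * Lr.toAlg x)) • 1 :=
  twist_coe r (comm x y)

/-- The element `v^{ij}(m,n)` of `𝓛_r`. -/
def vL {d : ℕ} (r : ℂ) (i j : Fin d) (m n : ℤ) : Lr d r := ⟨vv i j m n, vv_mem_calL i j m n⟩

/-! ### The subalgebra `𝓛_r⁺`, and its one-dimensional module -/

theorem setBplus_span {d : ℕ} {i j : Fin d} {m n : ℤ} (h : 0 ≤ m ∨ 0 ≤ n) :
    vv i j m n ∈ Submodule.span ℂ (setBplus d) ⊔ Submodule.span ℂ {1} := by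
  have key : vv i j m n = vv j i n m + (if m + n = 0 ∧ i = j then (m : ℂ) else 0) • 1 :=
    hv_comm i j m n
  have h1 : (1 : Weyl d) ∈ Submodule.span ℂ (setBplus d) ⊔ Submodule.span ℂ {1} :=
    Submodule.mem_sup_right (Submodule.subset_span rfl)
  have hB : ∀ x ∈ setBplus d, x ∈ Submodule.span ℂ (setBplus d) ⊔ Submodule.span ℂ {1} :=
    fun x hx => Submodule.mem_sup_left (Submodule.subset_span hx)
  rcases lt_trichotomy i j with hij | rfl | hij
  · exact hB _ (Or.inr ⟨i, j, m, n, hij, h, rfl⟩)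
  · rcases le_total m n with hmn | hmn
    · exact hB _ (Or.inl ⟨i, m, n, hmn, h, rfl⟩)
    · rw [key]
      exact add_mem (hB _ (Or.inl ⟨i, n, m, hmn, h.symm, rfl⟩)) (Submodule.smul_mem _ _ h1)
  · rw [key]
    exact add_mem (hB _ (Or.inr ⟨j, i, n, m, hij, h.symm, rfl⟩)) (Submodule.smul_mem _ _ h1)

theorem commutator_mem_plus {d : ℕ} {x y : Weyl d}
    (hx : x ∈ Submodule.span ℂ (setBplus d) ⊔ Submodule.span ℂ {1})
    (hy : y ∈ Submodule.span ℂ (setBplus d) ⊔ Submodule.span ℂ {1}) :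
    x * y - y * x ∈ Submodule.span ℂ (setBplus d) ⊔ Submodule.span ℂ {1} := by
  have hB : ∀ z ∈ setBplus d, ∃ i j m n, (0 ≤ m ∨ 0 ≤ n) ∧ z = vv i j m n := by
    rintro z (⟨i, m, n, -, h, rfl⟩ | ⟨i, j, m, n, -, h, rfl⟩)
    exacts [⟨_, _, _, _, h, rfl⟩, ⟨_, _, _, _, h, rfl⟩]
  have term : ∀ (i l : Fin d) (P : Prop) [Decidable P] (a m q : ℤ),
      (P → a ≠ 0 → 0 ≤ m ∨ 0 ≤ q) → (if P then (a : ℂ) else 0) • vv i l m q ∈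
        Submodule.span ℂ (setBplus d) ⊔ Submodule.span ℂ {1} := by
    intro i l P _ a m q h
    by_cases hP : P
    · by_cases ha : a = 0
      · simp [ha]
      · exact Submodule.smul_mem _ _ (setBplus_span (h hP ha))
    · simp [hP]
  rw [← Submodule.span_union] at hx hy
  induction hx using Submodule.span_induction with
  | zero => simp
  | add a b _ _ ha hb =>
    rw [show (a + b) * y - y * (a + b) = (a * y - y * a) + (b * y - y * b) by noncomm_ring]
    exact add_mem ha hb
  | smul t a _ ha =>
    rw [smul_mul_assoc, mul_smul_comm, ← smul_sub]
    exact Submodule.smul_mem _ _ ha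
  | mem a ha =>
    induction hy using Submodule.span_induction with
    | zero => simp
    | add b c _ _ hb hc =>
      rw [show a * (b + c) - (b + c) * a = (a * b - b * a) + (a * c - c * a) by noncomm_ring]
      exact add_mem hb hc
    | smul t b _ hb =>
      rw [smul_mul_assoc, mul_smul_comm, ← smul_sub]
      exact Submodule.smul_mem _ _ hb
    | mem b hb =>
      rcases ha with ha | rfl
      · rcases hb with hb | rfl
        · obtain ⟨i, j, m, n, h, rfl⟩ := hB a ha
          obtain ⟨k, l, p, q, h', rfl⟩ := hB b hb
          rw [vv_comm]
          exact add_mem (add_mem (add_mem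
            (term _ _ _ _ _ _ (by omega)) (term _ _ _ _ _ _ (by omega)))
            (term _ _ _ _ _ _ (by omega))) (term _ _ _ _ _ _ (by omega))
        · simp
      · simp

/-- The Lie subalgebra `𝓛_r⁺ = Span B₊ ⊕ ℂ` of `𝓛_r`. -/
def Lplus (d : ℕ) (r : ℂ) : LieSubalgebra ℂ (Lr d r) where
  toSubmodule := (Submodule.span ℂ (setBplus d) ⊔ Submodule.span ℂ {1}).comap Lr.toAlg
  lie_mem' {x y} hx hy := by
    change Lr.toAlg ⁅x, y⁆ ∈ Submodule.span ℂ (setBplus d) ⊔ Submodule.span ℂ {1}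
    rw [Lr_lie_toAlg]
    exact add_mem (commutator_mem_plus hx hy) (Submodule.smul_mem _ _
      (Submodule.mem_sup_right (Submodule.subset_span rfl)))

theorem plus_one {d : ℕ} {x : Weyl d}
    (hx : x ∈ Submodule.span ℂ (setBplus d) ⊔ Submodule.span ℂ {1}) :
    weylRep d x 1 = vacExp d x • 1 := by
  rw [← Submodule.span_union] at hx
  induction hx using Submodule.span_induction with
  | zero => simp
  | add a b _ _ ha hb => simp [ha, hb, add_smul]
  | smul t a _ ha => simp [ha, smul_smul]
  | mem a ha =>
    rcases ha with ha | rfl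
    · rw [vacExp_apply, setBplus_one ha, map_zero, zero_smul]
    · simp [vacExp_one]

theorem vacExp_lie_plus {d : ℕ} {r : ℂ} (x y : Lplus d r) :
    vacExp d (Lr.toAlg ⁅(x : Lr d r), (y : Lr d r)⁆) = 0 := by
  have h : vacExp d (Lr.toAlg (x : Lr d r) * Lr.toAlg (y : Lr d r) -
      Lr.toAlg (y : Lr d r) * Lr.toAlg (x : Lr d r)) = 0 := by
    rw [vacExp_apply, map_sub, map_mul, map_mul, LinearMap.sub_apply, Module.End.mul_apply,
      Module.End.mul_apply, plus_one x.2, plus_one y.2, map_smul, map_smul, plus_one x.2,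
      plus_one y.2, smul_comm, sub_self, map_zero]
  rw [Lr_lie_toAlg, h, mul_zero, zero_smul, add_zero, h]

/-- The one-dimensional space `ℂ𝟏`. -/
def VacuumLine (_d : ℕ) (_r : ℂ) : Type := ℂ

instance (d : ℕ) (r : ℂ) : AddCommGroup (VacuumLine d r) := inferInstanceAs (AddCommGroup ℂ)

instance (d : ℕ) (r : ℂ) : Module ℂ (VacuumLine d r) := inferInstanceAs (Module ℂ ℂ)

/-- The basis vector `𝟏` of `ℂ𝟏`. -/
def VacuumLine.one (d : ℕ) (r : ℂ) : VacuumLine d r := (1 : ℂ)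

/-- An element of `𝓛_r⁺` acts on `ℂ𝟏` by its component in `ℂ` along `Span B₊`
(see `Lplus_act_setBplus` and `Lplus_act_scalar`). -/
instance (d : ℕ) (r : ℂ) : LieRingModule (Lplus d r) (VacuumLine d r) where
  bracket x u := vacExp d (Lr.toAlg (x : Lr d r)) • u
  add_lie x y u := by
    rw [← add_smul, ← map_add, ← map_add]; rfl
  lie_add x u v := smul_add _ _ _
  leibniz_lie x y u := by
    have h := vacExp_lie_plus x y
    change _ = vacExp d (Lr.toAlg ⁅(x : Lr d r), (y : Lr d r)⁆) • u + _
    rw [h, zero_smul, zero_add, smul_comm]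

instance (d : ℕ) (r : ℂ) : LieModule ℂ (Lplus d r) (VacuumLine d r) where
  smul_lie t x u := by
    change vacExp d (Lr.toAlg (t • (x : Lr d r))) • u = t • vacExp d (Lr.toAlg (x : Lr d r)) • u
    rw [map_smul, map_smul, smul_assoc]
  lie_smul t x u := smul_comm _ _ _

/-- Elements of `B₊` act on `ℂ𝟏` by zero. -/
theorem Lplus_act_setBplus {d : ℕ} {r : ℂ} (x : Lplus d r)
    (hx : Lr.toAlg (x : Lr d r) ∈ setBplus d) (u : VacuumLine d r) : ⁅x, u⁆ = 0 := by
  change vacExp d (Lr.toAlg (x : Lr d r)) • u = 0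
  rw [vacExp_apply, setBplus_one hx, map_zero, zero_smul]

/-- A scalar `s` in `ℂ ⊂ 𝓛_r⁺` acts on `ℂ𝟏` by `s`. -/
theorem Lplus_act_scalar {d : ℕ} {r : ℂ} (x : Lplus d r) (s : ℂ)
    (hx : Lr.toAlg (x : Lr d r) = s • 1) (u : VacuumLine d r) : ⁅x, u⁆ = s • u := by
  change vacExp d (Lr.toAlg (x : Lr d r)) • u = s • u
  rw [hx, map_smul, vacExp_one, smul_eq_mul, mul_one]

/-! ### Induced modules -/

section Induced

variable {L : Type} [LieRing L] [LieAlgebra ℂ L] (K : LieSubalgebra ℂ L)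
  (V : Type) [AddCommGroup V] [Module ℂ V] [LieRingModule K V] [LieModule ℂ K V]

/-- The map `U(K) → U(L)` of enveloping algebras induced by the inclusion of `K` in `L`. -/
def envIncl : UniversalEnvelopingAlgebra ℂ K →ₐ[ℂ] UniversalEnvelopingAlgebra ℂ L :=
  UniversalEnvelopingAlgebra.lift ℂ ((UniversalEnvelopingAlgebra.ι ℂ).comp K.incl)

/-- The action of `U(K)` on a `K`-module. -/
def envAct : UniversalEnvelopingAlgebra ℂ K →ₐ[ℂ] Module.End ℂ V :=
  UniversalEnvelopingAlgebra.lift ℂ (LieModule.toEnd ℂ K V)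

/-- The relations `ab ⊗ v = a ⊗ bv`, for `a` in `U(L)`, `b` in `U(K)` and `v` in `V`. -/
def balanced : Submodule (UniversalEnvelopingAlgebra ℂ L)
    (UniversalEnvelopingAlgebra ℂ L ⊗[ℂ] V) :=
  Submodule.span _ {z | ∃ (a : UniversalEnvelopingAlgebra ℂ L)
    (b : UniversalEnvelopingAlgebra ℂ K) (v : V),
      z = (a * envIncl K b) ⊗ₜ[ℂ] v - a ⊗ₜ[ℂ] (envAct K V b v)}

/-- The induced module `U(L) ⊗_{U(K)} V`. -/
abbrev Induced : Type := (UniversalEnvelopingAlgebra ℂ L ⊗[ℂ] V) ⧸ balanced K V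

instance : LieRingModule L (Induced K V) where
  bracket x u := UniversalEnvelopingAlgebra.ι ℂ x • u
  add_lie x y u := by rw [map_add, add_smul]
  lie_add x u v := smul_add _ _ _
  leibniz_lie x y u := by
    rw [LieHom.map_lie, LieRing.of_associative_ring_bracket, sub_smul, mul_smul, mul_smul,
      sub_add_cancel]

instance : LieModule ℂ L (Induced K V) where
  smul_lie t x u := by
    change UniversalEnvelopingAlgebra.ι ℂ (t • x) • u = t • UniversalEnvelopingAlgebra.ι ℂ x • u
    rw [map_smul, smul_assoc]
  lie_smul t x u := by
    change UniversalEnvelopingAlgebra.ι ℂ x • t • u = t • UniversalEnvelopingAlgebra.ι ℂ x • u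
    rw [smul_comm]

end Induced

/-! ### The modules `M_r` and `M_r⁽¹⁾` -/

/-- The `𝓛_r`-module `M_r = U(𝓛_r) ⊗_{U(𝓛_r⁺)} ℂ𝟏`. -/
abbrev Mr (d : ℕ) (r : ℂ) : Type := Induced (Lplus d r) (VacuumLine d r)

/-- The vector `𝟏` of `M_r`. -/
def vac (d : ℕ) (r : ℂ) : Mr d r := Submodule.Quotient.mk (1 ⊗ₜ[ℂ] VacuumLine.one d r)

/-- The Lie subalgebra of `𝓛_r` generated by the `v^{ii}(m,n)` with `m ≤ n`; it is `𝓛_r⁽¹⁾`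
for the first index `i`. -/
def Lone {d : ℕ} (r : ℂ) (i : Fin d) : LieSubalgebra ℂ (Lr d r) :=
  LieSubalgebra.lieSpan ℂ (Lr d r) {x | ∃ m n : ℤ, m ≤ n ∧ x = vL r i i m n}

/-- The submodule `M_r⁽¹⁾ = U(𝓛_r⁽¹⁾)𝟏` over `𝓛_r⁽¹⁾` generated by `𝟏`. -/
def Mone {d : ℕ} (r : ℂ) (i : Fin d) : LieSubmodule ℂ (Lone r i) (Mr d r) :=
  LieSubmodule.lieSpan ℂ (Lone r i) {vac d r}

/-! ### Reducibility and maximal proper submodules -/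

/-- A module is reducible if it has a submodule that is neither zero nor the whole module. -/
def IsReducible (L M : Type) [LieRing L] [LieAlgebra ℂ L] [AddCommGroup M] [Module ℂ M]
    [LieRingModule L M] : Prop :=
  ∃ W : LieSubmodule ℂ L M, W ≠ ⊥ ∧ W ≠ ⊤

/-- `W` is the maximal proper submodule: it is proper and contains every proper submodule. -/
def IsMaximalProper {L M : Type} [LieRing L] [LieAlgebra ℂ L] [AddCommGroup M] [Module ℂ M]
    [LieRingModule L M] (W : LieSubmodule ℂ L M) : Prop :=
  IsGreatest {N : LieSubmodule ℂ L M | N ≠ ⊤} W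

/-- The `𝓛_r`-submodule `U(𝓛_r)W` of `M_r` generated by a submodule `W` of `M_r⁽¹⁾`. -/
def generated {d : ℕ} {r : ℂ} {i : Fin d} (W : LieSubmodule ℂ (Lone r i) (Mone r i)) :
    LieSubmodule ℂ (Lr d r) (Mr d r) :=
  LieSubmodule.lieSpan ℂ (Lr d r) {u | ∃ w ∈ W, u = (w : Mr d r)}

/-- The intersection `W ∩ M_r⁽¹⁾`, as an `𝓛_r⁽¹⁾`-submodule of `M_r⁽¹⁾`. -/
def intersection {d : ℕ} {r : ℂ} (i : Fin d) (W : LieSubmodule ℂ (Lr d r) (Mr d r)) :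
    LieSubmodule ℂ (Lone r i) (Mone r i) where
  carrier := {w | (w : Mr d r) ∈ W}
  add_mem' ha hb := W.add_mem ha hb
  zero_mem' := W.zero_mem
  smul_mem' t _ h := W.smul_mem t h
  lie_mem {x _} h := W.lie_mem (x := (x : Lr d r)) h

end JordanVOA

end

noncomputable section

namespace JordanVOA

open scoped TensorProduct

attribute [local instance] LieRing.ofAssociativeRing

/-! ### Linear algebra -/

section LinearAlgebra

variable {V : Type} [AddCommGroup V] [Module ℂ V]

/-! `M_r` is spanned by monomials in the creation pairs `cre`, applied to the vacuum, and `M_r⁽¹⁾`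
by those monomials that use only modes of the first component. The elements `mat` of `𝓛_r` satisfy
the relations of matrix units, and `mat r a b` replaces one occurrence of the mode `b` by `a`. Two
consequences carry the proof.

Grading. The diagonal matrix units count modes, so every submodule splits according to these counts.
A proper submodule misses the vacuum and therefore lies in `positivePart`, the span of the nonempty
monomials (`le_positivePart`). If the vacuum is nonzero, it is not in `positivePart`; hence the sum
of all proper submodules of `M_r` is proper.

Exchange of modes. A mode outside the first component can be traded for an unused mode of the first
component and recovered by `sl₂` theory (`mem_of_replace_mode`). Hence a submodule `W` of `M_r` is
generated by `W ∩ M_r⁽¹⁾` (`le_generated_intersection`).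

It remains to see that a proper submodule `W` of `M_r⁽¹⁾` generates a proper submodule
(`generated_le_positivePart`). The algebra `𝓛_r` is spanned by elements that preserve `positivePart`
and elements that preserve `W`; a rearrangement in the style of Poincaré-Birkhoff-Witt then keeps
the generated submodule inside `positivePart`. So generation and intersection both preserve
properness, and the proposition follows formally. Linear independence of the monomials is never
needed. -/

theorem mem_of_sum_mem_of_eigen (D : Module.End ℂ V) (W : Submodule ℂ V)
    (hW : ∀ u ∈ W, D u ∈ W) (s : Finset ℕ) (f : ℕ → V) (hf : ∀ k, D (f k) = (k : ℂ) • f k)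
    (hs : ∑ k ∈ s, f k ∈ W) : ∀ k ∈ s, f k ∈ W := by
  induction s using Finset.induction_on generalizing f with
  | empty => simp
  | insert a s ha ih =>
    -- The operator `D - a` kills the term of index `a` and rescales the others by nonzero factors,
    -- which are divided out after the induction hypothesis.
    have h1 : ∑ k ∈ s, ((k : ℂ) - a) • f k ∈ W := by
      have h2 := W.sub_mem (hW _ hs) (W.smul_mem (a : ℂ) hs)
      rw [map_sum, Finset.smul_sum, ← Finset.sum_sub_distrib, Finset.sum_insert ha] at h2
      simpa only [hf, ← sub_smul, sub_self, zero_smul, zero_add] using h2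
    have h3 := ih (fun k => ((k : ℂ) - a) • f k)
      (fun k => by rw [map_smul, hf, smul_comm]) h1
    have h4 : ∀ k ∈ s, f k ∈ W := by
      intro k hk
      have hka : ((k : ℂ) - a) ≠ 0 := by
        rw [sub_ne_zero]
        exact fun h => ha (Nat.cast_injective h ▸ hk)
      simpa only [smul_smul, inv_mul_cancel₀ hka, one_smul] using
        W.smul_mem ((k : ℂ) - a)⁻¹ (h3 k hk)
    intro k hk
    rcases Finset.mem_insert.mp hk with rfl | hk
    · rw [Finset.sum_insert ha] at hs
      exact (W.add_mem_iff_left (W.sum_mem h4)).mp hs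
    · exact h4 k hk

/-- A subspace stable under `D` is graded by the eigenspaces of `D`. -/
theorem mem_iSup_inf_of_eigen (D : Module.End ℂ V) (W : Submodule ℂ V)
    (hW : ∀ u ∈ W, D u ∈ W) (p : ℕ → Submodule ℂ V)
    (hp : ∀ k, ∀ u ∈ p k, D u = (k : ℂ) • u) {u : V} (hu : u ∈ W) (hup : u ∈ ⨆ k, p k) :
    u ∈ ⨆ k, W ⊓ p k := by
  obtain ⟨f, hf, rfl⟩ := (Submodule.mem_iSup_iff_exists_finsupp p u).mp hup
  have h := mem_of_sum_mem_of_eigen D W hW f.support f (fun k => hp k _ (hf k)) hu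
  exact Submodule.sum_mem _ fun k hk => Submodule.mem_iSup_of_mem k ⟨h k hk, hf k⟩

/-- An eigenvector of `D` lies in the summand of its eigenvalue. -/
theorem mem_of_eigen (D : Module.End ℂ V) (p : ℕ → Submodule ℂ V)
    (hp : ∀ k, ∀ u ∈ p k, D u = (k : ℂ) • u) {u : V} {n : ℕ} (hu : D u = (n : ℂ) • u)
    (hup : u ∈ ⨆ k, p k) : u ∈ p n := by
  -- The grading is applied to the eigenspace of `n` itself; its intersection with `p k` is zero for
  -- `k ≠ n`.
  have h := mem_iSup_inf_of_eigen D (LinearMap.ker (D - (n : ℂ) • 1))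
    (fun v hv => by
      have hv' : D v = (n : ℂ) • v := by simpa [sub_eq_zero] using hv
      simp [hv']) p hp (by simp [hu]) hup
  refine (iSup_le (fun k => ?_) : (⨆ k, _ ⊓ p k) ≤ p n) h
  rintro v ⟨hv, hvk⟩
  have hv' : D v = (n : ℂ) • v := by simpa [sub_eq_zero] using hv
  by_cases hkn : k = n
  · exact hkn ▸ hvk
  · have h0 : ((k : ℂ) - n) • v = 0 := by rw [sub_smul, ← hp k v hvk, hv', sub_self]
    rcases smul_eq_zero.mp h0 with h0 | h0
    · exact absurd (Nat.cast_injective (sub_eq_zero.mp h0)) hkn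
    · rw [h0]; exact zero_mem _

end LinearAlgebra

/-! ### Lie modules -/

section LieModules

variable {L : Type} [LieRing L] {V : Type} [AddCommGroup V] [Module ℂ V] [LieRingModule L V]

/-- The smallest subspace that contains `W` and is stable under `Q`. -/
def stableClosure (Q : Set L) (W : Submodule ℂ V) : Submodule ℂ V :=
  sInf {P | W ≤ P ∧ ∀ y ∈ Q, ∀ u ∈ P, ⁅y, u⁆ ∈ P}

theorem le_stableClosure (Q : Set L) (W : Submodule ℂ V) : W ≤ stableClosure Q W :=
  le_sInf fun _ h => h.1

theorem lie_mem_stableClosure {Q : Set L} {W : Submodule ℂ V} {y : L} (hy : y ∈ Q) {u : V}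
    (hu : u ∈ stableClosure Q W) : ⁅y, u⁆ ∈ stableClosure Q W := by
  rw [stableClosure, Submodule.mem_sInf] at hu ⊢
  exact fun P hP => hP.2 y hy u (hu P hP)

theorem stableClosure_le {Q : Set L} {W P : Submodule ℂ V} (h : W ≤ P)
    (h' : ∀ y ∈ Q, ∀ u ∈ P, ⁅y, u⁆ ∈ P) : stableClosure Q W ≤ P :=
  sInf_le ⟨h, h'⟩

variable [LieAlgebra ℂ L] [LieModule ℂ L V]

theorem lie_mem_of_span {S : Set L} {P : Submodule ℂ V} {u : V} (h : ∀ x ∈ S, ⁅x, u⁆ ∈ P)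
    {x : L} (hx : x ∈ Submodule.span ℂ S) : ⁅x, u⁆ ∈ P := by
  induction hx using Submodule.span_induction with
  | zero => rw [zero_lie]; exact zero_mem _
  | add a b _ _ ha hb => rw [add_lie]; exact add_mem ha hb
  | smul t a _ ha => rw [smul_lie]; exact P.smul_mem t ha
  | mem a ha => exact h a ha

/-- If `W` is stable under `Q'` and `[Q', Q]` is contained in the span of `Q` and `Q'`, then
the closure of `W` under `Q` is stable under `Q'`. -/
theorem lie_mem_stableClosure_of_comm {Q Q' : Set L} {W : Submodule ℂ V}
    (hQ : ∀ x ∈ Q', ∀ y ∈ Q, ⁅x, y⁆ ∈ Submodule.span ℂ (Q ∪ Q'))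
    (hW : ∀ x ∈ Q', ∀ u ∈ W, ⁅x, u⁆ ∈ W) {x : L} (hx : x ∈ Submodule.span ℂ (Q ∪ Q')) {u : V}
    (hu : u ∈ stableClosure Q W) : ⁅x, u⁆ ∈ stableClosure Q W := by
  -- `R` consists of the vectors of the closure that `Q'` keeps in the closure. It contains `W`, and
  -- it is stable under `Q` because `x y v = [x, y] v + y x v`; so it is the whole closure.
  let R : Submodule ℂ V :=
    { carrier := {u | u ∈ stableClosure Q W ∧ ∀ x ∈ Q', ⁅x, u⁆ ∈ stableClosure Q W}
      add_mem' := fun ha hb => ⟨add_mem ha.1 hb.1, fun x hx => by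
        rw [lie_add]; exact add_mem (ha.2 x hx) (hb.2 x hx)⟩
      zero_mem' := ⟨zero_mem _, fun x _ => by rw [lie_zero]; exact zero_mem _⟩
      smul_mem' := fun t a ha => ⟨Submodule.smul_mem _ t ha.1, fun x hx => by
        rw [lie_smul]; exact Submodule.smul_mem _ t (ha.2 x hx)⟩ }
  have hR : ∀ v ∈ R, ∀ x ∈ Submodule.span ℂ (Q ∪ Q'), ⁅x, v⁆ ∈ stableClosure Q W := by
    intro v hv x hx
    refine lie_mem_of_span (fun y hy => ?_) hx
    rcases hy with hy | hy
    · exact lie_mem_stableClosure hy hv.1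
    · exact hv.2 y hy
  have h : stableClosure Q W ≤ R := by
    refine stableClosure_le (fun u hu => ⟨le_stableClosure Q W hu, fun x hx =>
      le_stableClosure Q W (hW x hx u hu)⟩) (fun y hy v hv => ⟨lie_mem_stableClosure hy hv.1,
        fun x hx => ?_⟩)
    rw [leibniz_lie]
    exact add_mem (hR v hv _ (hQ x hx y hy)) (lie_mem_stableClosure hy (hv.2 x hx))
  exact hR u (h hu) x hx

/-- In a representation of `sl₂`, a vector `u` with `e u = 0` and `h u = k u` satisfies
`e ^ k f ^ k u = (k!)² u`; so it can be recovered from `f ^ k u`. -/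
theorem lie_pow_lie_pow_of_primitive {e f h : L} (hef : ⁅e, f⁆ = h) (hhf : ⁅h, f⁆ = (-2 : ℂ) • f)
    {u : V} {k : ℕ} (heu : ⁅e, u⁆ = 0) (hhu : ⁅h, u⁆ = (k : ℂ) • u) :
    ((LieModule.toEnd ℂ L V e) ^ k * (LieModule.toEnd ℂ L V f) ^ k) u =
      ((k.factorial : ℂ) ^ 2) • u := by
  have h1 : ∀ n : ℕ, ⁅h, (LieModule.toEnd ℂ L V f ^ n) u⁆ =
      ((k : ℂ) - 2 * n) • (LieModule.toEnd ℂ L V f ^ n) u := by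
    intro n
    induction n with
    | zero => simp [hhu]
    | succ n ih =>
      rw [pow_succ', Module.End.mul_apply, LieModule.toEnd_apply_apply, leibniz_lie, hhf, ih,
        smul_lie, lie_smul, ← add_smul]
      push_cast; ring_nf
  have h2 : ∀ n : ℕ, ⁅e, (LieModule.toEnd ℂ L V f ^ (n + 1)) u⁆ =
      (((n : ℂ) + 1) * (k - n)) • (LieModule.toEnd ℂ L V f ^ n) u := by
    intro n
    induction n with
    | zero => simp [leibniz_lie e, hef, heu, hhu]
    | succ n ih =>
      rw [pow_succ', Module.End.mul_apply, LieModule.toEnd_apply_apply, leibniz_lie, hef, ih,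
        h1, lie_smul, ← LieModule.toEnd_apply_apply ℂ L V f, ← Module.End.mul_apply, ← pow_succ',
        ← add_smul]
      congr 1
      push_cast; ring
  -- The factors `(j + 1)(k - j)` from `h2`, for `j < n`, are multiplied up. The bound on `n` lets
  -- the truncated subtraction in `descFactorial` be cast to `ℂ`.
  have h3 : ∀ n : ℕ, n ≤ k → ((LieModule.toEnd ℂ L V e) ^ n * (LieModule.toEnd ℂ L V f) ^ n) u =
      ((n.factorial : ℂ) * k.descFactorial n) • u := by
    intro n
    induction n with
    | zero => intro _; simp
    | succ n ih =>
      intro hn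
      rw [Module.End.mul_apply, pow_succ (LieModule.toEnd ℂ L V e), Module.End.mul_apply,
        LieModule.toEnd_apply_apply, h2, map_smul, ← Module.End.mul_apply, ih (by omega), smul_smul,
        Nat.factorial_succ, Nat.descFactorial_succ]
      congr 1
      push_cast [Nat.cast_sub (show n ≤ k by omega)]
      ring
  rw [h3 k le_rfl, Nat.descFactorial_self, sq]

/-- The stabilizer of a subspace. -/
def stabilizer (P : Submodule ℂ V) : LieSubalgebra ℂ L where
  carrier := {x | ∀ u ∈ P, ⁅x, u⁆ ∈ P}
  add_mem' ha hb u hu := by rw [add_lie]; exact add_mem (ha u hu) (hb u hu)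
  zero_mem' u _ := by rw [zero_lie]; exact zero_mem _
  smul_mem' t a ha u hu := by rw [smul_lie]; exact P.smul_mem t (ha u hu)
  lie_mem' {a b} ha hb u hu := by
    rw [lie_lie]; exact sub_mem (ha _ (hb u hu)) (hb _ (ha u hu))

end LieModules

/-! ### Induced modules -/

section InducedModules

variable {L : Type} [LieRing L] [LieAlgebra ℂ L] (K : LieSubalgebra ℂ L)
  (V : Type) [AddCommGroup V] [Module ℂ V] [LieRingModule K V] [LieModule ℂ K V]

theorem Induced.lie_mk (x : L) (t : UniversalEnvelopingAlgebra ℂ L ⊗[ℂ] V) :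
    (⁅x, (Submodule.Quotient.mk t : Induced K V)⁆ : Induced K V) =
      Submodule.Quotient.mk (UniversalEnvelopingAlgebra.ι ℂ x • t) := rfl

/-- This is the balancing relation with left factor `1`. -/
theorem Induced.lie_mk_one_tmul (x : K) (v : V) :
    (⁅(x : L), (Submodule.Quotient.mk (1 ⊗ₜ[ℂ] v) : Induced K V)⁆ : Induced K V) =
      Submodule.Quotient.mk (1 ⊗ₜ[ℂ] ⁅x, v⁆) := by
  rw [Induced.lie_mk, Submodule.Quotient.eq]
  refine Submodule.subset_span ⟨1, UniversalEnvelopingAlgebra.ι ℂ x, v, ?_⟩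
  rw [envIncl, envAct, UniversalEnvelopingAlgebra.lift_ι_apply,
    UniversalEnvelopingAlgebra.lift_ι_apply, one_mul, TensorProduct.smul_tmul', smul_eq_mul,
    mul_one]
  rfl

/-- `U(L)` is generated by `L`: the elements of `U(L)` that preserve `N` form a subalgebra `S`
through which `ι` factors, and by the universal property the lift `U(L) → S` followed by the
inclusion is the identity. -/
theorem Induced.smul_mem (N : LieSubmodule ℂ L (Induced K V)) (a : UniversalEnvelopingAlgebra ℂ L)
    {u : Induced K V} (hu : u ∈ N) : a • u ∈ N := by
  let S : Subalgebra ℂ (UniversalEnvelopingAlgebra ℂ L) :=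
    { carrier := {a | ∀ u ∈ N, a • u ∈ N}
      mul_mem' := fun ha hb u hu => by rw [mul_smul]; exact ha _ (hb u hu)
      add_mem' := fun ha hb u hu => by rw [add_smul]; exact N.add_mem (ha u hu) (hb u hu)
      algebraMap_mem' := fun t u hu => by
        rw [algebraMap_smul]; exact N.smul_mem t hu }
  let g : L →ₗ⁅ℂ⁆ S :=
    { toFun := fun x => ⟨UniversalEnvelopingAlgebra.ι ℂ x, fun u hu => N.lie_mem (x := x) hu⟩
      map_add' := fun x y => Subtype.ext (map_add _ x y)
      map_smul' := fun t x => Subtype.ext (map_smul _ t x)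
      map_lie' := fun {x y} => Subtype.ext (LieHom.map_lie _ x y) }
  have h : S.val.comp (UniversalEnvelopingAlgebra.lift ℂ g) = AlgHom.id ℂ _ := by
    apply UniversalEnvelopingAlgebra.hom_ext
    refine LieHom.ext fun x => ?_
    change ((UniversalEnvelopingAlgebra.lift ℂ g (UniversalEnvelopingAlgebra.ι ℂ x) : S) :
      UniversalEnvelopingAlgebra ℂ L) = UniversalEnvelopingAlgebra.ι ℂ x
    rw [UniversalEnvelopingAlgebra.lift_ι_apply]
    rfl
  have h' : ((UniversalEnvelopingAlgebra.lift ℂ g a : S) : UniversalEnvelopingAlgebra ℂ L) = a :=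
    congrArg (fun F => F a) h
  rw [← h']
  exact (UniversalEnvelopingAlgebra.lift ℂ g a).2 u hu

end InducedModules

/-! ### Brackets in `𝓛_r` -/

section Brackets

variable {d : ℕ} {r : ℂ}

theorem toAlg_vL (i j : Fin d) (m n : ℤ) : Lr.toAlg (vL r i j m n) = vv i j m n := rfl

theorem toAlg_injective : Function.Injective (Lr.toAlg : Lr d r → Weyl d) :=
  fun _ _ h => Subtype.ext h

/-- The element `1` of `ℂ ⊂ 𝓛_r`. -/
def unitL (d : ℕ) (r : ℂ) : Lr d r := ⟨1, one_mem_calL d⟩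

theorem toAlg_unitL : Lr.toAlg (unitL d r) = 1 := rfl

theorem lie_unitL (x : Lr d r) : ⁅x, unitL d r⁆ = 0 := by
  apply toAlg_injective
  rw [Lr_lie_toAlg, toAlg_unitL]
  simp

theorem unitL_lie (x : Lr d r) : ⁅unitL d r, x⁆ = 0 := by
  rw [← lie_skew, lie_unitL, neg_zero]

theorem vacExp_vv_of_neg (i j : Fin d) {m : ℤ} (n : ℤ) (hm : m < 0) :
    vacExp d (vv i j m n) = 0 := by
  rw [vacExp_apply, vv, map_mul, weylRep_hv, Module.End.mul_apply, fockOp, if_pos hm,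
    LinearMap.mulLeft_apply, map_mul, MvPolynomial.aeval_X, zero_mul]

theorem vacExp_vv_of_nonneg (i j : Fin d) (m : ℤ) {n : ℤ} (hn : 0 ≤ n) :
    vacExp d (vv i j m n) = 0 := by
  rw [vacExp_apply, vv_one_of_nonneg _ _ _ _ hn, map_zero]

theorem vacExp_vv_of_ne {i j : Fin d} (h : i ≠ j) (m n : ℤ) : vacExp d (vv i j m n) = 0 := by
  rcases lt_or_ge m 0 with hm | hm
  · exact vacExp_vv_of_neg _ _ _ hm
  · rw [vacExp_apply, vv_one_of_ne _ _ _ _ h (Or.inl hm), map_zero]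

theorem vL_swap {i j : Fin d} {m n : ℤ} (h : ¬ (m + n = 0 ∧ i = j)) :
    vL r i j m n = vL r j i n m := by
  apply toAlg_injective
  rw [toAlg_vL, toAlg_vL]
  have := hv_comm i j m n
  rw [if_neg h, zero_smul, add_zero] at this
  exact this

/-- The commutator of the associative algebra of two elements `v^{ij}(m,n)`. -/
def commL (r : ℂ) (i j k l : Fin d) (m n p q : ℤ) : Lr d r :=
  (if n + p = 0 ∧ j = k then (n : ℂ) else 0) • vL r i l m q +
  (if m + p = 0 ∧ i = k then (m : ℂ) else 0) • vL r j l n q +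
  (if n + q = 0 ∧ j = l then (n : ℂ) else 0) • vL r k i p m +
  (if m + q = 0 ∧ i = l then (m : ℂ) else 0) • vL r k j p n

theorem vL_lie (i j k l : Fin d) (m n p q : ℤ) :
    ⁅vL r i j m n, vL r k l p q⁆ = commL r i j k l m n p q +
      ((r - 1) * vacExp d (Lr.toAlg (commL r i j k l m n p q))) • unitL d r := by
  have h : Lr.toAlg (vL r i j m n) * Lr.toAlg (vL r k l p q) -
      Lr.toAlg (vL r k l p q) * Lr.toAlg (vL r i j m n) =
        Lr.toAlg (commL r i j k l m n p q) := vv_comm i j k l m n p q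
  apply toAlg_injective
  rw [Lr_lie_toAlg, h, map_add, map_smul, toAlg_unitL]

/-- The parameter `r` enters a bracket only through the vacuum expectation of the commutator. When
every surviving contraction has expectation zero, the bracket is the associative commutator. -/
theorem vL_lie_of_vacExp {i j k l : Fin d} {m n p q : ℤ}
    (h1 : n + p = 0 → j = k → vacExp d (vv i l m q) = 0)
    (h2 : m + p = 0 → i = k → vacExp d (vv j l n q) = 0)
    (h3 : n + q = 0 → j = l → vacExp d (vv k i p m) = 0)
    (h4 : m + q = 0 → i = l → vacExp d (vv k j p n) = 0) :
    ⁅vL r i j m n, vL r k l p q⁆ = commL r i j k l m n p q := by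
  have key : ∀ (P Q : Prop) [Decidable (P ∧ Q)] (a z : ℂ), (P → Q → z = 0) →
      (if P ∧ Q then a else 0) * z = 0 := by
    intro P Q _ a z h
    split_ifs with hPQ
    · rw [h hPQ.1 hPQ.2, mul_zero]
    · rw [zero_mul]
  rw [vL_lie, commL]
  simp only [map_add, map_smul, toAlg_vL, smul_eq_mul, key _ _ _ _ h1, key _ _ _ _ h2,
    key _ _ _ _ h3, key _ _ _ _ h4, add_zero, mul_zero, zero_smul]

/-- A spanning set of `𝓛_r`. -/
theorem mem_span_of_forall {S : Set (Lr d r)} (h1 : unitL d r ∈ Submodule.span ℂ S)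
    (h2 : ∀ (i : Fin d) (m n : ℤ), m ≤ n → vL r i i m n ∈ Submodule.span ℂ S)
    (h3 : ∀ (i j : Fin d) (m n : ℤ), i < j → vL r i j m n ∈ Submodule.span ℂ S) (x : Lr d r) :
    x ∈ Submodule.span ℂ S := by
  have hle : calL d ≤ (Submodule.span ℂ S).map Lr.toAlg := by
    refine sup_le (Submodule.span_le.mpr ?_) (Submodule.span_le.mpr ?_)
    · rintro _ (⟨i, m, n, h, rfl⟩ | ⟨i, j, m, n, h, rfl⟩)
      · exact ⟨_, h2 i m n h, rfl⟩
      · exact ⟨_, h3 i j m n h, rfl⟩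
    · rintro _ rfl
      exact ⟨_, h1, rfl⟩
  obtain ⟨y, hy, hyx⟩ := hle x.2
  rwa [← toAlg_injective hyx]

theorem unitL_mem_Lplus : unitL d r ∈ Lplus d r :=
  Submodule.mem_sup_right (Submodule.subset_span rfl)

theorem vL_mem_Lplus {i j : Fin d} {m n : ℤ} (h : 0 ≤ m ∨ 0 ≤ n) : vL r i j m n ∈ Lplus d r :=
  setBplus_span h

/-- The indices `(i, n)` of the elements `v^i(-n-1)`. -/
abbrev Mode (d : ℕ) : Type := Fin d × ℕ

/-- The product of the creation operators of two modes. -/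
def cre (r : ℂ) (b c : Mode d) : Lr d r := vL r b.1 c.1 (-((b.2 : ℤ) + 1)) (-((c.2 : ℤ) + 1))

/-- The elements of `𝓛_r` that act on the creation operators as matrix units. -/
def mat (r : ℂ) (b c : Mode d) : Lr d r :=
  ((c.2 : ℂ) + 1)⁻¹ • vL r b.1 c.1 (-((b.2 : ℤ) + 1)) ((c.2 : ℤ) + 1)

theorem vL_eq_cre (i j : Fin d) {m n : ℤ} (hm : m < 0) (hn : n < 0) :
    ∃ a b : ℕ, vL r i j m n = cre r (i, a) (j, b) := by
  obtain ⟨a, ha⟩ := Int.eq_ofNat_of_zero_le (show 0 ≤ -m - 1 by omega)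
  obtain ⟨b, hb⟩ := Int.eq_ofNat_of_zero_le (show 0 ≤ -n - 1 by omega)
  refine ⟨a, b, ?_⟩
  rw [cre]
  congr 1 <;> simp only <;> omega

theorem cre_swap (b c : Mode d) : cre r b c = cre r c b :=
  vL_swap (by omega)

/-- Only the positive mode of `mat` can be contracted with a creation mode, and the contraction
constant is cancelled by the normalization of `mat`. The products that remain begin with a negative
mode, so no term in `r` appears. -/
theorem mat_lie_cre (a b c e : Mode d) :
    ⁅mat r a b, cre r c e⁆ = (if b = c then cre r a e else 0) + (if b = e then cre r c a else 0) := by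
  obtain ⟨i, m⟩ := a
  obtain ⟨j, n⟩ := b
  obtain ⟨k, p⟩ := c
  obtain ⟨l, q⟩ := e
  have hn : (n : ℂ) + 1 ≠ 0 := Nat.cast_add_one_ne_zero n
  rw [mat, cre, smul_lie, vL_lie_of_vacExp (fun _ _ => vacExp_vv_of_neg _ _ _ (by simp only; omega))
    (by simp only; omega) (fun _ _ => vacExp_vv_of_neg _ _ _ (by simp only; omega))
    (by simp only; omega), commL]
  rw [if_neg (c := _ ∧ i = k) (by simp only; omega), if_neg (c := _ ∧ i = l) (by simp only; omega),
    zero_smul, zero_smul, add_zero, add_zero, smul_add]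
  have e1 : ∀ (p : ℕ) (k : Fin d), (((n : ℤ) + 1 + -((p : ℤ) + 1) = 0 ∧ j = k) ↔ (j, n) = (k, p)) := by
    intro p k
    rw [Prod.mk.injEq]
    omega
  simp only [e1, ite_smul, zero_smul, smul_ite, smul_zero, smul_smul]
  push_cast
  simp only [inv_mul_cancel₀ hn, one_smul, cre]

/-- Again every surviving product begins with a negative mode, so the matrix units satisfy their
relations without a central term, for every `r`. -/
theorem mat_lie_mat (a b c e : Mode d) :
    ⁅mat r a b, mat r c e⁆ = (if b = c then mat r a e else 0) - (if a = e then mat r c b else 0) := by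
  obtain ⟨i, m⟩ := a
  obtain ⟨j, n⟩ := b
  obtain ⟨k, p⟩ := c
  obtain ⟨l, q⟩ := e
  have hn : (n : ℂ) + 1 ≠ 0 := Nat.cast_add_one_ne_zero n
  have hq : (q : ℂ) + 1 ≠ 0 := Nat.cast_add_one_ne_zero q
  rw [mat, mat, smul_lie, lie_smul,
    vL_lie_of_vacExp (fun _ _ => vacExp_vv_of_neg _ _ _ (by simp only; omega))
    (by simp only; omega) (by simp only; omega)
    (fun _ _ => vacExp_vv_of_neg _ _ _ (by simp only; omega)), commL]
  rw [if_neg (c := _ ∧ i = k) (by simp only; omega), if_neg (c := _ ∧ j = l) (by simp only; omega),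
    zero_smul, zero_smul, add_zero, add_zero, smul_add, smul_add, sub_eq_add_neg]
  have e1 : (((n : ℤ) + 1 + -((p : ℤ) + 1) = 0 ∧ j = k) ↔ (j, n) = (k, p)) := by
    rw [Prod.mk.injEq]; omega
  have e2 : ((-((m : ℤ) + 1) + ((q : ℤ) + 1) = 0 ∧ i = l) ↔ (i, m) = (l, q)) := by
    rw [Prod.mk.injEq]; omega
  simp only [e1, e2]
  congr 1
  · split_ifs with h
    · rw [mat, smul_smul, smul_smul]
      congr 1
      push_cast
      field_simp
    · simp
  · split_ifs with h
    · rw [mat, smul_smul, smul_smul, ← neg_smul]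
      obtain ⟨-, rfl⟩ := Prod.mk.injEq .. ▸ h
      congr 1
      push_cast
      field_simp
    · simp

theorem mat_mem_Lplus (b c : Mode d) : mat r b c ∈ Lplus d r :=
  (Lplus d r).smul_mem _ (vL_mem_Lplus (Or.inr (by omega)))

theorem vacExp_mat (b c : Mode d) : vacExp d (Lr.toAlg (mat r b c)) = 0 := by
  rw [mat, map_smul, map_smul, toAlg_vL, vacExp_vv_of_neg _ _ _ (by omega), smul_zero]

end Brackets

/-! ### Monomials in the creation operators -/

section Monomials

variable {d : ℕ} {r : ℂ} {V : Type} [AddCommGroup V] [Module ℂ V]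
  [LieRingModule (Lr d r) V]

/-- The list of the modes that occur in a list of pairs of modes. -/
def modes (l : List (Mode d × Mode d)) : List (Mode d) := l.flatMap fun p => [p.1, p.2]

theorem modes_cons (p : Mode d × Mode d) (l : List (Mode d × Mode d)) :
    modes (p :: l) = p.1 :: p.2 :: modes l := rfl

/-- The number of occurrences of elements of `S`. -/
def degreeIn (S : Finset (Mode d)) (l : List (Mode d × Mode d)) : ℕ :=
  ∑ b ∈ S, (modes l).count b

/-- The lists in which only modes from `A` occur. -/
def supported (A : Set (Mode d)) : Set (List (Mode d × Mode d)) := {l | ∀ b ∈ modes l, b ∈ A}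

/-- A product of creation operators, applied to `ω`. -/
def monomial (r : ℂ) [LieRingModule (Lr d r) V] (ω : V) (l : List (Mode d × Mode d)) : V :=
  l.foldr (fun p u => ⁅cre r p.1 p.2, u⁆) ω

omit [Module ℂ V] in
theorem monomial_cons (ω : V) (p : Mode d × Mode d) (l : List (Mode d × Mode d)) :
    monomial r ω (p :: l) = ⁅cre r p.1 p.2, monomial r ω l⁆ := rfl

/-- The span of the monomials of a set of lists. -/
def monomialSpan (r : ℂ) [LieRingModule (Lr d r) V] (ω : V) (C : Set (List (Mode d × Mode d))) :
    Submodule ℂ V :=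
  Submodule.span ℂ (monomial r ω '' C)

/-- `𝓛_r⁺` acts on `ω` as on `ℂ𝟏`. -/
def IsVacuum (d : ℕ) (r : ℂ) {V : Type} [AddCommGroup V] [Module ℂ V]
    [LieRingModule (Lr d r) V] (ω : V) : Prop := ∀ x ∈ Lplus d r, ⁅x, ω⁆ = vacExp d (Lr.toAlg x) • ω

variable {ω : V}

theorem monomial_mem_monomialSpan {C : Set (List (Mode d × Mode d))} {l : List (Mode d × Mode d)}
    (h : l ∈ C) : monomial r ω l ∈ monomialSpan r ω C :=
  Submodule.subset_span ⟨l, h, rfl⟩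

theorem monomialSpan_mono {C C' : Set (List (Mode d × Mode d))} (h : C ⊆ C') :
    monomialSpan r ω C ≤ monomialSpan r ω C' :=
  Submodule.span_mono (Set.image_mono h)

theorem supported_mono {A B : Set (Mode d)} (h : A ⊆ B) : supported A ⊆ supported B :=
  fun _ hl b hb => h (hl b hb)

theorem cons_mem_supported {A : Set (Mode d)} {p : Mode d × Mode d} {l : List (Mode d × Mode d)} :
    p :: l ∈ supported A ↔ p.1 ∈ A ∧ p.2 ∈ A ∧ l ∈ supported A := by
  simp only [supported, Set.mem_ofPred_eq, modes_cons, List.forall_mem_cons]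

theorem monomialSpan_le {C : Set (List (Mode d × Mode d))} {P : Submodule ℂ V}
    (h : ∀ l ∈ C, monomial r ω l ∈ P) : monomialSpan r ω C ≤ P := by
  refine Submodule.span_le.mpr ?_
  rintro _ ⟨l, hl, rfl⟩
  exact h l hl

/-- Serves as the induction principle on monomials, for instance to show that an operator kills
`M_r⁽¹⁾`. -/
theorem monomialSpan_supported_le {A : Set (Mode d)} {P : Submodule ℂ V} (hω : ω ∈ P)
    (hP : ∀ b ∈ A, ∀ c ∈ A, ∀ u ∈ P, ⁅cre r b c, u⁆ ∈ P) :
    monomialSpan r ω (supported A) ≤ P := by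
  refine monomialSpan_le fun l hl => ?_
  induction l with
  | nil => exact hω
  | cons p l ih =>
    obtain ⟨h1, h2, h3⟩ := cons_mem_supported.mp hl
    exact hP _ h1 _ h2 _ (ih h3)

theorem mem_iSup_monomialSpan (S : Finset (Mode d)) {C : Set (List (Mode d × Mode d))} {u : V}
    (hu : u ∈ monomialSpan r ω C) : u ∈ ⨆ k, monomialSpan r ω (C ∩ {l | degreeIn S l = k}) :=
  monomialSpan_le (P := ⨆ k, monomialSpan r ω (C ∩ {l | degreeIn S l = k}))
    (fun l hl => Submodule.mem_iSup_of_mem (degreeIn S l)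
      (monomial_mem_monomialSpan ⟨hl, rfl⟩)) hu

/-- Finiteness is needed twice: `number` counts only finitely many modes, and a fresh mode must be
available for the exchange. -/
theorem exists_finset_of_mem {B : Set (Mode d)} {u : V}
    (hu : u ∈ monomialSpan r ω (supported B)) :
    ∃ S : Finset (Mode d), (S : Set (Mode d)) ⊆ B ∧
      u ∈ monomialSpan r ω (supported (S : Set (Mode d))) := by
  induction hu using Submodule.span_induction with
  | zero => exact ⟨∅, by simp, zero_mem _⟩
  | add a b _ _ ha hb =>
    obtain ⟨S, hS, ha⟩ := ha
    obtain ⟨T, hT, hb⟩ := hb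
    refine ⟨S ∪ T, by simp [hS, hT], add_mem ?_ ?_⟩
    · exact monomialSpan_mono (supported_mono (by simp)) ha
    · exact monomialSpan_mono (supported_mono (by simp)) hb
  | smul t a _ ha =>
    obtain ⟨S, hS, ha⟩ := ha
    exact ⟨S, hS, Submodule.smul_mem _ t ha⟩
  | mem a ha =>
    obtain ⟨l, hl, rfl⟩ := ha
    exact ⟨(modes l).toFinset, fun b hb => hl b (by simpa using hb),
      monomial_mem_monomialSpan fun b hb => by simpa using hb⟩

theorem degreeIn_pos {S : Finset (Mode d)} {l : List (Mode d × Mode d)}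
    (hl : l ∈ supported (S : Set (Mode d))) (h : l ≠ []) : degreeIn S l ≠ 0 := by
  cases l with
  | nil => exact absurd rfl h
  | cons p l =>
    have h1 := (cons_mem_supported.mp hl).1
    intro h0
    have := (Finset.sum_eq_zero_iff.mp h0) p.1 h1
    simp [modes_cons] at this

theorem mat_lie_vacuum (hω : IsVacuum d r ω) (b c : Mode d) : ⁅mat r b c, ω⁆ = 0 := by
  rw [hω _ (mat_mem_Lplus b c), vacExp_mat, zero_smul]

/-- There is no occurrence of `b` to be replaced by `a`. -/
theorem mat_lie_monomial_of_notMem (hω : IsVacuum d r ω) (a : Mode d) {b : Mode d}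
    {l : List (Mode d × Mode d)} (h : b ∉ modes l) : ⁅mat r a b, monomial r ω l⁆ = 0 := by
  induction l with
  | nil => exact mat_lie_vacuum hω a b
  | cons p l ih =>
    rw [modes_cons, List.mem_cons, List.mem_cons, not_or, not_or] at h
    rw [monomial_cons, leibniz_lie, ih h.2.2, lie_zero, mat_lie_cre, if_neg h.1, if_neg h.2.1]
    simp

variable [LieModule ℂ (Lr d r) V]

theorem lie_mem_monomialSpan {x : Lr d r} {C : Set (List (Mode d × Mode d))} {P : Submodule ℂ V}
    (h : ∀ l ∈ C, ⁅x, monomial r ω l⁆ ∈ P) {u : V} (hu : u ∈ monomialSpan r ω C) : ⁅x, u⁆ ∈ P := by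
  have : monomialSpan r ω C ≤ P.comap (LieModule.toEnd ℂ (Lr d r) V x) := monomialSpan_le h
  exact this hu

theorem cre_lie_mem {A : Set (Mode d)} {b c : Mode d} (hb : b ∈ A) (hc : c ∈ A) {u : V}
    (hu : u ∈ monomialSpan r ω (supported A)) :
    ⁅cre r b c, u⁆ ∈ monomialSpan r ω (supported A) :=
  lie_mem_monomialSpan (fun l hl => monomial_mem_monomialSpan (l := (b, c) :: l)
    (cons_mem_supported.mpr (And.intro hb (And.intro hc hl)))) hu

/-- The span of the monomials with modes in `A` is stable under `Q'` if `Q'` stabilizes the line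
of `ω` and is stable under commutators with the creation operators, up to creation operators. -/
theorem lie_mem_monomialSpan_supported {A : Set (Mode d)} {Q' : Set (Lr d r)}
    (hQ : ∀ x ∈ Q', ∀ b ∈ A, ∀ c ∈ A, ⁅x, cre r b c⁆ ∈
      Submodule.span ℂ ({y | ∃ b ∈ A, ∃ c ∈ A, y = cre r b c} ∪ Q'))
    (hω : ∀ x ∈ Q', ∃ s : ℂ, ⁅x, ω⁆ = s • ω) {x : Lr d r}
    (hx : x ∈ Submodule.span ℂ ({y | ∃ b ∈ A, ∃ c ∈ A, y = cre r b c} ∪ Q')) {u : V}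
    (hu : u ∈ monomialSpan r ω (supported A)) : ⁅x, u⁆ ∈ monomialSpan r ω (supported A) := by
  have h : stableClosure {y | ∃ b ∈ A, ∃ c ∈ A, y = cre r b c} (Submodule.span ℂ {ω}) =
      monomialSpan r ω (supported A) := by
    apply le_antisymm
    · refine stableClosure_le ?_ ?_
      · rw [Submodule.span_singleton_le_iff_mem]
        exact monomial_mem_monomialSpan (l := []) (by simp [supported, modes])
      · rintro _ ⟨b, hb, c, hc, rfl⟩ u hu
        exact cre_lie_mem hb hc hu
    · exact monomialSpan_supported_le (le_stableClosure _ _ (Submodule.mem_span_singleton_self ω))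
        fun b hb c hc u hu => lie_mem_stableClosure
          (show cre r b c ∈ {y | ∃ b ∈ A, ∃ c ∈ A, y = cre r b c} from ⟨b, hb, c, hc, rfl⟩) hu
  rw [← h] at hu ⊢
  refine lie_mem_stableClosure_of_comm ?_ ?_ hx hu
  · rintro x hx _ ⟨b, hb, c, hc, rfl⟩
    exact hQ x hx b hb c hc
  · intro x hx u hu
    obtain ⟨t, rfl⟩ := Submodule.mem_span_singleton.mp hu
    obtain ⟨s, hs⟩ := hω x hx
    rw [lie_smul, hs, smul_smul]
    exact Submodule.smul_mem _ _ (Submodule.mem_span_singleton_self ω)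

theorem mat_lie_mem (hω : IsVacuum d r ω) {A : Set (Mode d)} {a : Mode d} (ha : a ∈ A)
    (b : Mode d) {u : V} (hu : u ∈ monomialSpan r ω (supported A)) :
    ⁅mat r a b, u⁆ ∈ monomialSpan r ω (supported A) := by
  refine lie_mem_monomialSpan (fun l hl => ?_) hu
  induction l with
  | nil => rw [monomial, List.foldr_nil, mat_lie_vacuum hω]; exact zero_mem _
  | cons p l ih =>
    obtain ⟨h1, h2, h3⟩ := cons_mem_supported.mp hl
    have h4 := monomial_mem_monomialSpan (r := r) (ω := ω) h3
    rw [monomial_cons, leibniz_lie, mat_lie_cre, add_lie]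
    refine add_mem (add_mem ?_ ?_) (cre_lie_mem h1 h2 (ih h3))
    · split_ifs
      · exact cre_lie_mem ha h2 h4
      · rw [zero_lie]; exact zero_mem _
    · split_ifs
      · exact cre_lie_mem h1 ha h4
      · rw [zero_lie]; exact zero_mem _

/-! ### Counting operators and the grading -/

theorem mat_self_lie_monomial (hω : IsVacuum d r ω) (b : Mode d)
    (l : List (Mode d × Mode d)) :
    ⁅mat r b b, monomial r ω l⁆ = ((modes l).count b : ℂ) • monomial r ω l := by
  induction l with
  | nil => simp [monomial, mat_lie_vacuum hω, modes]
  | cons p l ih =>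
    obtain ⟨c, e⟩ := p
    rw [monomial_cons, leibniz_lie, ih, mat_lie_cre, modes_cons, List.count_cons, List.count_cons,
      lie_smul, add_lie]
    by_cases h1 : c = b <;> by_cases h2 : e = b
    · subst h1; subst h2
      simp; module
    · subst h1
      simp [h2, Ne.symm h2]; module
    · subst h2
      simp [h1, Ne.symm h1]; module
    · simp [h1, h2, Ne.symm h1, Ne.symm h2]

/-- The operator that counts the modes in `S`. -/
def number (r : ℂ) (S : Finset (Mode d)) : Lr d r := ∑ b ∈ S, mat r b b

theorem number_lie (S : Finset (Mode d)) (u : V) : ⁅number r S, u⁆ = ∑ b ∈ S, ⁅mat r b b, u⁆ := by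
  have := map_sum (LieModule.toEnd ℂ (Lr d r) V) (fun b => mat r b b) S
  rw [← LieModule.toEnd_apply_apply ℂ (Lr d r) V, number, this, LinearMap.sum_apply]
  rfl

theorem number_lie_monomial (hω : IsVacuum d r ω) (S : Finset (Mode d))
    (l : List (Mode d × Mode d)) :
    ⁅number r S, monomial r ω l⁆ = (degreeIn S l : ℂ) • monomial r ω l := by
  rw [number_lie, degreeIn, Nat.cast_sum, Finset.sum_smul]
  exact Finset.sum_congr rfl fun b _ => mat_self_lie_monomial hω b l

theorem number_lie_of_mem (hω : IsVacuum d r ω) {S : Finset (Mode d)}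
    {C : Set (List (Mode d × Mode d))} {k : ℕ} {u : V}
    (hu : u ∈ monomialSpan r ω (C ∩ {l | degreeIn S l = k})) :
    ⁅number r S, u⁆ = (k : ℂ) • u := by
  have h : monomialSpan r ω (C ∩ {l | degreeIn S l = k}) ≤
      LinearMap.ker (LieModule.toEnd ℂ (Lr d r) V (number r S) - (k : ℂ) • 1) := by
    refine monomialSpan_le fun l hl => ?_
    have := number_lie_monomial hω S l
    rw [hl.2] at this
    simp [this]
  simpa [sub_eq_zero] using h hu

/-- The span of the monomials of positive degree. -/
def positivePart (d : ℕ) (r : ℂ) {V : Type} [AddCommGroup V] [Module ℂ V]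
    [LieRingModule (Lr d r) V] (ω : V) : Submodule ℂ V :=
  monomialSpan r ω {l : List (Mode d × Mode d) | l ≠ []}

/-- A relation expressing `ω` through nonempty monomials involves finitely many modes. Their number
operator has eigenvalue `0` on `ω` and a positive eigenvalue on each of these monomials, so the
eigenvalue argument forces `ω = 0`. -/
theorem vacuum_notMem_positivePart (hω : IsVacuum d r ω) (h0 : ω ≠ 0) :
    ω ∉ positivePart d r ω := by
  intro h
  have key : ∀ u ∈ positivePart d r ω, ∃ S : Finset (Mode d),
      u ∈ monomialSpan r ω (supported (S : Set (Mode d)) ∩ {l | l ≠ []}) := by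
    intro u hu
    rw [positivePart, monomialSpan] at hu
    induction hu using Submodule.span_induction with
    | zero => exact ⟨∅, zero_mem _⟩
    | add a b _ _ ha hb =>
      obtain ⟨S, ha⟩ := ha
      obtain ⟨T, hb⟩ := hb
      refine ⟨S ∪ T, add_mem ?_ ?_⟩
      · exact monomialSpan_mono (Set.inter_subset_inter_left _ (supported_mono (by simp))) ha
      · exact monomialSpan_mono (Set.inter_subset_inter_left _ (supported_mono (by simp))) hb
    | smul t a _ ha =>
      obtain ⟨S, ha⟩ := ha
      exact ⟨S, Submodule.smul_mem _ t ha⟩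
    | mem a ha =>
      obtain ⟨l, hl, rfl⟩ := ha
      exact ⟨(modes l).toFinset, monomial_mem_monomialSpan ⟨fun b hb => by simpa using hb, hl⟩⟩
  obtain ⟨S, hS⟩ := key ω h
  have h2 : ⁅number r S, ω⁆ = ((0 : ℕ) : ℂ) • ω := by
    have := number_lie_monomial hω S []
    simpa [degreeIn, modes, monomial] using this
  have h3 := mem_of_eigen (LieModule.toEnd ℂ (Lr d r) V (number r S)) _
    (fun k u hu => number_lie_of_mem hω hu) h2 (mem_iSup_monomialSpan S hS)
  have h4 : (supported (S : Set (Mode d)) ∩ {l | l ≠ []}) ∩ {l | degreeIn S l = 0} = ∅ := by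
    ext l
    simp only [Set.mem_inter_iff, Set.mem_ofPred_eq, Set.mem_empty_iff_false, iff_false]
    rintro ⟨⟨hl, hne⟩, h0⟩
    exact degreeIn_pos hl hne h0
  rw [h4, monomialSpan, Set.image_empty, Submodule.span_empty, Submodule.mem_bot] at h3
  exact h0 h3

/-- A subspace that does not contain the vacuum has no component in degree zero. -/
theorem le_positivePart (hω : IsVacuum d r ω) {B : Set (Mode d)} {W : Submodule ℂ V}
    (hWB : W ≤ monomialSpan r ω (supported B))
    (hW : ∀ b ∈ B, ∀ u ∈ W, ⁅mat r b b, u⁆ ∈ W) (h : ω ∉ W) : W ≤ positivePart d r ω := by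
  intro u hu
  obtain ⟨S, hSB, hS⟩ := exists_finset_of_mem (hWB hu)
  have h1 := mem_iSup_inf_of_eigen (LieModule.toEnd ℂ (Lr d r) V (number r S)) W
    (fun v hv => by
      rw [LieModule.toEnd_apply_apply, number_lie]
      exact W.sum_mem fun b hb => hW b (hSB hb) v hv) _
    (fun k u hu => number_lie_of_mem hω hu) hu (mem_iSup_monomialSpan S hS)
  refine (iSup_le fun k => ?_ : (⨆ k, W ⊓ _) ≤ positivePart d r ω) h1
  -- In degree zero only the line of `ω` is left, and a nonzero multiple of `ω` in `W` would put `ω`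
  -- in `W`.
  rcases Nat.eq_zero_or_pos k with rfl | hk
  · rintro v ⟨hvW, hv⟩
    have h2 : monomialSpan r ω (supported (S : Set (Mode d)) ∩ {l | degreeIn S l = 0}) ≤
        Submodule.span ℂ {ω} := by
      refine monomialSpan_le fun l hl => ?_
      have : l = [] := by
        by_contra hne
        exact degreeIn_pos hl.1 hne hl.2
      subst this
      exact Submodule.mem_span_singleton_self ω
    obtain ⟨t, rfl⟩ := Submodule.mem_span_singleton.mp (h2 hv)
    by_cases ht : t = 0
    · rw [ht, zero_smul]; exact zero_mem _
    · have := W.smul_mem t⁻¹ hvW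
      rw [smul_smul, inv_mul_cancel₀ ht, one_smul] at this
      exact absurd this h
  · refine inf_le_right.trans (monomialSpan_mono (C' := {l | l ≠ []}) fun l hl => ?_)
    rintro rfl
    have : degreeIn S ([] : List (Mode d × Mode d)) = k := hl.2
    simp [degreeIn, modes] at this
    omega

/-! ### Exchange of modes -/

theorem lie_pow_mem_of_stable {x : Lr d r} {P : Submodule ℂ V} (h : ∀ u ∈ P, ⁅x, u⁆ ∈ P) {u : V}
    (hu : u ∈ P) (n : ℕ) : (LieModule.toEnd ℂ (Lr d r) V x ^ n) u ∈ P := by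
  induction n with
  | zero => simpa using hu
  | succ n ih =>
    rw [pow_succ', Module.End.mul_apply]
    exact h _ ih

/-- If a mode `b` is replaced by a mode `b'` that does not occur, then membership in a
stable subspace can be tested after the replacement. -/
theorem mem_of_replace_mode (hω : IsVacuum d r ω) {A : Set (Mode d)} {b b' : Mode d}
    (hbb : b' ≠ b) (hb : b ∈ A) (hb' : b' ∉ A) {W N : Submodule ℂ V}
    (hW : ∀ u ∈ W, ⁅mat r b b, u⁆ ∈ W) (hW' : ∀ u ∈ W, ⁅mat r b' b, u⁆ ∈ W)
    (hN : ∀ u ∈ N, ⁅mat r b b', u⁆ ∈ N)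
    (h : W ⊓ monomialSpan r ω (supported (insert b' A \ {b})) ≤ N) :
    W ⊓ monomialSpan r ω (supported A) ≤ N := by
  rintro u ⟨huW, huA⟩
  have hnum : ∀ v : V, ⁅number r {b}, v⁆ = ⁅mat r b b, v⁆ := fun v => by simp [number_lie]
  -- It suffices to treat a vector `v` in which `b` occurs exactly `k` times in each monomial.
  have h1 := mem_iSup_inf_of_eigen (LieModule.toEnd ℂ (Lr d r) V (number r {b})) W
    (fun v hv => by
      rw [LieModule.toEnd_apply_apply, hnum]
      exact hW v hv) _
    (fun k u hu => number_lie_of_mem hω hu) huW (mem_iSup_monomialSpan {b} huA)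
  refine (iSup_le fun k => ?_ : (⨆ k, W ⊓ _) ≤ N) h1
  rintro v ⟨hvW, hv⟩
  have hvA : v ∈ monomialSpan r ω (supported A) := monomialSpan_mono Set.inter_subset_left hv
  have hHb : ⁅mat r b b, v⁆ = (k : ℂ) • v := by rw [← hnum]; exact number_lie_of_mem hω hv
  -- Since `b'` does not occur in `v`, the vector is primitive of weight `k` for the `sl₂`-triple
  -- with `e = mat r b b'` and `f = mat r b' b`.
  have hvan : ∀ a, ⁅mat r a b', v⁆ = 0 := by
    intro a
    have := lie_mem_monomialSpan (x := mat r a b') (P := ⊥) (fun l (hl : l ∈ supported A) => by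
      rw [mat_lie_monomial_of_notMem hω a fun hmem => hb' (hl _ hmem)]; exact zero_mem _) hvA
    simpa using this
  have hef : ⁅mat r b b', mat r b' b⁆ = mat r b b - mat r b' b' := by simp [mat_lie_mat]
  have hhf : ⁅mat r b b - mat r b' b', mat r b' b⁆ = (-2 : ℂ) • mat r b' b := by
    rw [sub_lie, mat_lie_mat, mat_lie_mat]
    simp [hbb, hbb.symm]
    module
  have hprim := lie_pow_lie_pow_of_primitive hef hhf (u := v) (k := k) (hvan b)
    (by rw [sub_lie, hHb, hvan, sub_zero])
  -- Each application of `f` uses up one `b`, so `b` has count zero in `w = f ^ k v` and `w` can be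
  -- written without `b`.
  have hwt : ∀ n : ℕ, ⁅mat r b b, (LieModule.toEnd ℂ (Lr d r) V (mat r b' b) ^ n) v⁆ =
      ((k : ℂ) - n) • (LieModule.toEnd ℂ (Lr d r) V (mat r b' b) ^ n) v := by
    intro n
    induction n with
    | zero => simp [hHb]
    | succ n ih =>
      rw [pow_succ', Module.End.mul_apply, LieModule.toEnd_apply_apply, leibniz_lie, ih,
        mat_lie_mat, if_neg hbb.symm, if_pos rfl, zero_sub, neg_lie, lie_smul]
      push_cast
      module
  set w := (LieModule.toEnd ℂ (Lr d r) V (mat r b' b) ^ k) v with hw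
  have hwW : w ∈ W := lie_pow_mem_of_stable hW' hvW k
  have hwA : w ∈ monomialSpan r ω (supported (insert b' A)) :=
    lie_pow_mem_of_stable (fun u hu => mat_lie_mem hω (Set.mem_insert b' A) b hu)
      (monomialSpan_mono (supported_mono (Set.subset_insert b' A)) hvA) k
  have hw0 : ⁅number r {b}, w⁆ = ((0 : ℕ) : ℂ) • w := by
    rw [hnum, hwt k, sub_self, Nat.cast_zero]
  have hwA' := mem_of_eigen (LieModule.toEnd ℂ (Lr d r) V (number r {b})) _
    (fun k u hu => number_lie_of_mem hω hu) hw0 (mem_iSup_monomialSpan {b} hwA)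
  have hwN : w ∈ N := h ⟨hwW, monomialSpan_mono (fun l hl c hc => ⟨hl.1 c hc, by
    rintro rfl
    have : degreeIn {c} l = 0 := hl.2
    rw [degreeIn, Finset.sum_singleton, List.count_eq_zero] at this
    exact this hc⟩) hwA'⟩
  rw [Module.End.mul_apply, ← hw] at hprim
  -- Applying `e ^ k` inside `N` gives back `(k!)² v`.
  have h2 := lie_pow_mem_of_stable hN hwN k
  rw [hprim] at h2
  have h3 := N.smul_mem (((k.factorial : ℂ) ^ 2)⁻¹) h2
  rwa [smul_smul, inv_mul_cancel₀ (pow_ne_zero 2 (Nat.cast_ne_zero.mpr k.factorial_ne_zero)),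
    one_smul] at h3

end Monomials

/-! ### The modules `M_r` and `M_r⁽¹⁾` -/

section VacuumModules

variable {d : ℕ} {r : ℂ}

theorem isVacuum_vac : IsVacuum d r (vac d r) := by
  intro x hx
  have h := Induced.lie_mk_one_tmul (Lplus d r) (VacuumLine d r) ⟨x, hx⟩ (VacuumLine.one d r)
  refine h.trans ?_
  change Submodule.Quotient.mk (1 ⊗ₜ[ℂ] (vacExp d (Lr.toAlg x) • VacuumLine.one d r)) = _
  rw [TensorProduct.tmul_smul]
  rfl

/-- `M_r` is cyclic: each pure tensor is a scalar multiple of `a • (1 ⊗ 𝟏)`, because `VacuumLine` is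
one-dimensional. -/
theorem eq_top_of_vac_mem {N : LieSubmodule ℂ (Lr d r) (Mr d r)} (h : vac d r ∈ N) : N = ⊤ := by
  rw [eq_top_iff]
  rintro u -
  obtain ⟨t, rfl⟩ := Submodule.Quotient.mk_surjective _ u
  induction t using TensorProduct.induction_on with
  | zero => rw [Submodule.Quotient.mk_zero]; exact N.zero_mem
  | add a b ha hb => rw [Submodule.Quotient.mk_add]; exact N.add_mem ha hb
  | tmul a v =>
    have hv : v = (show ℂ from v) • VacuumLine.one d r := (mul_one (show ℂ from v)).symm
    have h1 : (a ⊗ₜ[ℂ] v : UniversalEnvelopingAlgebra ℂ (Lr d r) ⊗[ℂ] VacuumLine d r) =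
        (show ℂ from v) • (a • (1 ⊗ₜ[ℂ] VacuumLine.one d r)) := by
      rw [TensorProduct.smul_tmul', smul_eq_mul, mul_one, ← TensorProduct.tmul_smul, ← hv]
    rw [h1]
    exact N.smul_mem _ (Induced.smul_mem _ _ N a h)

theorem vL_lie_vac {i j : Fin d} {m n : ℤ} (h : 0 ≤ m ∨ 0 ≤ n) (h0 : vacExp d (vv i j m n) = 0) :
    ⁅vL r i j m n, vac d r⁆ = 0 := by
  rw [isVacuum_vac _ (vL_mem_Lplus h), toAlg_vL, h0, zero_smul]

theorem mem_span_cre_Lplus (x : Lr d r) :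
    x ∈ Submodule.span ℂ ({y | ∃ b ∈ (Set.univ : Set (Mode d)), ∃ c ∈ (Set.univ : Set (Mode d)),
      y = cre r b c} ∪ (Lplus d r : Set (Lr d r))) := by
  have h : ∀ (i j : Fin d) (m n : ℤ), vL r i j m n ∈ Submodule.span ℂ
      ({y | ∃ b ∈ (Set.univ : Set (Mode d)), ∃ c ∈ (Set.univ : Set (Mode d)),
        y = cre r b c} ∪ (Lplus d r : Set (Lr d r))) := by
    intro i j m n
    apply Submodule.subset_span
    by_cases hmn : 0 ≤ m ∨ 0 ≤ n
    · exact Or.inr (vL_mem_Lplus hmn)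
    · obtain ⟨a, b, hab⟩ := vL_eq_cre (r := r) i j (show m < 0 by omega) (show n < 0 by omega)
      exact Or.inl ⟨_, trivial, _, trivial, hab⟩
  exact mem_span_of_forall (Submodule.subset_span (Or.inr unitL_mem_Lplus))
    (fun i m n _ => h i i m n) (fun i j m n _ => h i j m n) x

/-- `M_r` is spanned by the monomials in the creation operators. -/
theorem mem_monomialSpan_univ (u : Mr d r) :
    u ∈ monomialSpan r (vac d r) (supported (Set.univ : Set (Mode d))) := by
  let N : LieSubmodule ℂ (Lr d r) (Mr d r) :=
    { monomialSpan r (vac d r) (supported (Set.univ : Set (Mode d))) with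
      lie_mem := fun {x u} hu => lie_mem_monomialSpan_supported
        (fun x _ b _ c _ => mem_span_cre_Lplus _)
        (fun x hx => ⟨_, isVacuum_vac x hx⟩) (mem_span_cre_Lplus x) hu }
  have hN : N = ⊤ := eq_top_of_vac_mem
    (monomial_mem_monomialSpan (l := []) (by simp [supported, modes]))
  have : u ∈ N := hN ▸ LieSubmodule.mem_top u
  exact this

/-- `unitL` commutes with the creation operators and fixes the vacuum. It follows that `unitL`
preserves every subspace. -/
theorem unitL_lie_eq (u : Mr d r) : ⁅unitL d r, u⁆ = u := by
  have h : monomialSpan r (vac d r) (supported (Set.univ : Set (Mode d))) ≤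
      LinearMap.ker (LieModule.toEnd ℂ (Lr d r) (Mr d r) (unitL d r) - 1) := by
    refine monomialSpan_supported_le ?_ fun b _ c _ u hu => ?_
    · simp [isVacuum_vac _ unitL_mem_Lplus, toAlg_unitL, vacExp_one]
    · have hu' : ⁅unitL d r, u⁆ = u := by simpa [sub_eq_zero] using hu
      simp [leibniz_lie (unitL d r), unitL_lie, hu']
  simpa [sub_eq_zero] using h (mem_monomialSpan_univ u)

theorem cre_lie_mem_positivePart (b c : Mode d) (u : Mr d r) :
    ⁅cre r b c, u⁆ ∈ positivePart d r (vac d r) :=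
  lie_mem_monomialSpan (fun l _ => monomial_mem_monomialSpan (l := (b, c) :: l)
    (List.cons_ne_nil _ _)) (mem_monomialSpan_univ u)

theorem vL_lie_mem_positivePart_of_neg (i j : Fin d) {m n : ℤ} (hm : m < 0) (hn : n < 0)
    (u : Mr d r) : ⁅vL r i j m n, u⁆ ∈ positivePart d r (vac d r) := by
  obtain ⟨a, b, hab⟩ := vL_eq_cre (r := r) i j hm hn
  rw [hab]
  exact cre_lie_mem_positivePart _ _ u

/-! ### The subalgebra `𝓛_r⁽¹⁾` -/

theorem vL_mem_Lone {i : Fin d} {m n : ℤ} (h : m ≤ n) : vL r i i m n ∈ Lone r i :=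
  LieSubalgebra.subset_lieSpan ⟨m, n, h, rfl⟩

theorem cre_mem_Lone {i : Fin d} {b c : Mode d} (hb : b.1 = i) (hc : c.1 = i) :
    cre r b c ∈ Lone r i := by
  obtain ⟨j, m⟩ := b
  obtain ⟨k, n⟩ := c
  obtain rfl : j = i := hb
  obtain rfl : k = j := hc
  rcases le_total m n with h | h
  · rw [cre_swap]
    exact vL_mem_Lone (by simp only; omega)
  · exact vL_mem_Lone (by simp only; omega)

theorem mat_mem_Lone {i : Fin d} {b c : Mode d} (hb : b.1 = i) (hc : c.1 = i) :
    mat r b c ∈ Lone r i := by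
  obtain ⟨j, m⟩ := b
  obtain ⟨k, n⟩ := c
  obtain rfl : j = i := hb
  obtain rfl : k = j := hc
  exact (Lone r k).smul_mem _ (vL_mem_Lone (by simp only; omega))

theorem lie_mem_Mone {i : Fin d} {x : Lr d r} (hx : x ∈ Lone r i) {u : Mr d r}
    (hu : u ∈ Mone r i) : ⁅x, u⁆ ∈ Mone r i :=
  (Mone r i).lie_mem (x := ⟨x, hx⟩) hu

theorem vac_mem_Mone (i : Fin d) : vac d r ∈ Mone r i :=
  LieSubmodule.subset_lieSpan rfl

/-- The modes of the first component. -/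
abbrev modesOf (i : Fin d) : Set (Mode d) := {b | b.1 = i}

/-- `M_r⁽¹⁾` is spanned by the monomials in the creation operators of the first component. -/
theorem mem_Mone_iff {i : Fin d} {u : Mr d r} :
    u ∈ Mone r i ↔ u ∈ monomialSpan r (vac d r) (supported (modesOf i)) := by
  constructor
  · let Q' : Set (Lr d r) := {x | ∃ m n : ℤ, (0 ≤ m ∨ 0 ≤ n) ∧ x = vL r i i m n} ∪ {unitL d r}
    let S : Submodule ℂ (Lr d r) := Submodule.span ℂ
      ({y | ∃ b ∈ modesOf i, ∃ c ∈ modesOf i, y = cre r b c} ∪ Q')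
    have hS : ∀ m n : ℤ, vL r i i m n ∈ S := by
      intro m n
      apply Submodule.subset_span
      by_cases hmn : 0 ≤ m ∨ 0 ≤ n
      · exact Or.inr (Or.inl ⟨m, n, hmn, rfl⟩)
      · obtain ⟨a, b, hab⟩ := vL_eq_cre (r := r) i i (show m < 0 by omega) (show n < 0 by omega)
        exact Or.inl ⟨(i, a), rfl, (i, b), rfl, hab⟩
    have hunit : unitL d r ∈ S := Submodule.subset_span (Or.inr (Or.inr rfl))
    -- The stabilizer is a Lie subalgebra, so only the generators of `Lone r i` need checking. Their
    -- brackets with creation pairs stay in first-component products plus multiples of `unitL`,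
    -- which is why `unitL` belongs to `Q'`.
    have hstab : Lone r i ≤
        stabilizer (monomialSpan r (vac d r) (supported (modesOf i))) := by
      rw [Lone, LieSubalgebra.lieSpan_le]
      rintro _ ⟨m, n, -, rfl⟩ u hu
      refine lie_mem_monomialSpan_supported (Q' := Q') ?_ ?_ (hS m n) hu
      · rintro _ (⟨m, n, -, rfl⟩ | rfl) ⟨j, b⟩ hb ⟨k, c⟩ hc
        · obtain rfl : j = i := hb
          obtain rfl : k = j := hc
          rw [cre, vL_lie, commL]
          exact add_mem (add_mem (add_mem (add_mem (S.smul_mem _ (hS _ _)) (S.smul_mem _ (hS _ _)))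
            (S.smul_mem _ (hS _ _))) (S.smul_mem _ (hS _ _))) (S.smul_mem _ hunit)
        · rw [unitL_lie]; exact zero_mem _
      · rintro _ (⟨m, n, hmn, rfl⟩ | rfl)
        · exact ⟨_, isVacuum_vac _ (vL_mem_Lplus hmn)⟩
        · exact ⟨_, isVacuum_vac _ unitL_mem_Lplus⟩
    let N : LieSubmodule ℂ (Lone r i) (Mr d r) :=
      { monomialSpan r (vac d r) (supported (modesOf i)) with
        lie_mem := fun {x u} hu => hstab x.2 u hu }
    have hN : Mone r i ≤ N := by
      rw [Mone, LieSubmodule.lieSpan_le, Set.singleton_subset_iff]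
      exact monomial_mem_monomialSpan (l := []) (by simp [supported, modes])
    exact fun hu => hN hu
  · intro hu
    exact monomialSpan_supported_le (P := (Mone r i).toSubmodule) (vac_mem_Mone i)
      (fun b hb c hc u hu => lie_mem_Mone (cre_mem_Lone hb hc) hu) hu

/-- The image in `M_r` of a submodule of `M_r⁽¹⁾`. -/
def imageInMr {i : Fin d} (W : LieSubmodule ℂ (Lone r i) (Mone r i)) :
    LieSubmodule ℂ (Lone r i) (Mr d r) :=
  W.map (Mone r i).incl

theorem mem_imageInMr {i : Fin d} {W : LieSubmodule ℂ (Lone r i) (Mone r i)} {u : Mr d r} :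
    u ∈ imageInMr W ↔ ∃ w ∈ W, (w : Mr d r) = u := by
  rw [imageInMr, LieSubmodule.mem_map]
  rfl

theorem coe_mem_imageInMr {i : Fin d} {W : LieSubmodule ℂ (Lone r i) (Mone r i)} {u : Mone r i} :
    (u : Mr d r) ∈ imageInMr W ↔ u ∈ W := by
  rw [mem_imageInMr]
  exact ⟨fun ⟨w, hw, h⟩ => Subtype.ext h ▸ hw, fun h => ⟨u, h, rfl⟩⟩

theorem Mone_eq_top_of_vac_mem {i : Fin d} {W : LieSubmodule ℂ (Lone r i) (Mone r i)}
    (h : vac d r ∈ imageInMr W) : W = ⊤ := by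
  rw [eq_top_iff]
  rintro u -
  have hle : Mone r i ≤ imageInMr W := by
    conv_lhs => rw [Mone]
    rw [LieSubmodule.lieSpan_le, Set.singleton_subset_iff]
    exact h
  exact coe_mem_imageInMr.mp (hle u.2)

/-- The counting operators of first-component modes lie in `Lone r i`, and these are the only modes
occurring in `M_r⁽¹⁾`; so the grading argument works over the subalgebra. -/
theorem imageInMr_le_positivePart {i : Fin d} {W : LieSubmodule ℂ (Lone r i) (Mone r i)}
    (h : W ≠ ⊤) : (imageInMr W).toSubmodule ≤ positivePart d r (vac d r) := by
  refine le_positivePart isVacuum_vac (B := modesOf i) ?_ ?_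
    (fun hv => h (Mone_eq_top_of_vac_mem hv))
  · intro u hu
    obtain ⟨w, -, rfl⟩ := mem_imageInMr.mp hu
    exact mem_Mone_iff.mp w.2
  · intro b hb u hu
    exact (imageInMr W).lie_mem (x := ⟨mat r b b, mat_mem_Lone hb hb⟩) hu

theorem proper_le_positivePart {W : LieSubmodule ℂ (Lr d r) (Mr d r)} (h : W ≠ ⊤) :
    W.toSubmodule ≤ positivePart d r (vac d r) :=
  le_positivePart isVacuum_vac (B := Set.univ) (fun u _ => mem_monomialSpan_univ u)
    (fun b _ _ hu => W.lie_mem (x := mat r b b) hu) (fun hv => h (eq_top_of_vac_mem hv))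

end VacuumModules

/-! ### Submodules generated by submodules of `M_r⁽¹⁾` -/

section Generated

variable {d : ℕ} {r : ℂ}

/-- Neither factor can be contracted with a first-component mode, so the operator commutes with
everything that builds `M_r⁽¹⁾` from the vacuum, and it kills the vacuum. -/
theorem vL_lie_Mone_of_ne {i j k : Fin d} (hj : j ≠ i) (hk : k ≠ i) {m n : ℤ}
    (h : 0 ≤ m ∨ 0 ≤ n) (h0 : vacExp d (vv j k m n) = 0) {u : Mr d r} (hu : u ∈ Mone r i) :
    ⁅vL r j k m n, u⁆ = 0 := by
  have hle : monomialSpan r (vac d r) (supported (modesOf i)) ≤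
      LinearMap.ker (LieModule.toEnd ℂ (Lr d r) (Mr d r) (vL r j k m n)) := by
    refine monomialSpan_supported_le ?_ ?_
    · exact vL_lie_vac h h0
    · rintro ⟨b, p⟩ hb ⟨c, q⟩ hc v hv
      obtain rfl : b = i := hb
      obtain rfl : c = b := hc
      have hv' : ⁅vL r j k m n, v⁆ = 0 := hv
      change ⁅vL r j k m n, ⁅_, v⁆⁆ = 0
      rw [leibniz_lie, hv', lie_zero, add_zero, cre, vL_lie]
      simp [commL, hj, hk]
  exact hle (mem_Mone_iff.mp hu)

/-- The factor `v^k(n)` kills the vacuum and meets no mode of its own component in `M_r⁽¹⁾`. -/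
theorem vL_lie_Mone_of_nonneg {i k : Fin d} (hk : k ≠ i) (m : ℤ) {n : ℤ} (h : 0 ≤ n)
    {u : Mr d r} (hu : u ∈ Mone r i) : ⁅vL r i k m n, u⁆ = 0 := by
  -- All `m` are treated at once: a bracket with a creation pair replaces `m` by a mode of that pair
  -- and keeps `k` and `n`.
  have hle : monomialSpan r (vac d r) (supported (modesOf i)) ≤
      ⨅ m : ℤ, LinearMap.ker (LieModule.toEnd ℂ (Lr d r) (Mr d r) (vL r i k m n)) := by
    refine monomialSpan_supported_le ?_ ?_
    · rw [Submodule.mem_iInf]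
      exact fun m => vL_lie_vac (Or.inr h) (vacExp_vv_of_ne hk.symm _ _)
    · rintro ⟨b, p⟩ hb ⟨c, q⟩ hc v hv
      obtain rfl : b = i := hb
      obtain rfl : c = b := hc
      rw [Submodule.mem_iInf] at hv ⊢
      intro m
      have hv' : ∀ m, ⁅vL r c k m n, v⁆ = 0 := hv
      change ⁅vL r c k m n, ⁅_, v⁆⁆ = 0
      rw [leibniz_lie, hv', lie_zero, add_zero, cre, vL_lie_of_vacExp
        (fun _ h => absurd h hk) (fun _ _ => vacExp_vv_of_ne hk _ _)
        (fun _ h => absurd h hk) (fun _ _ => vacExp_vv_of_ne hk.symm _ _), commL,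
        vL_swap (i := k) (j := c) fun h => hk h.2]
      simp only [hk, and_false, if_false, zero_smul, zero_add, add_zero, add_lie, smul_lie, hv',
        smul_zero]
  have := hle (mem_Mone_iff.mp hu)
  rw [Submodule.mem_iInf] at this
  exact this m

/-- As `n < 0`, at most the factor `v^i(m)` is contracted with a creation pair, and what remains is
again a creation pair. The degree therefore cannot drop to zero; two annihilating factors could make
it drop. -/
theorem vL_lie_mem_positivePart (i k : Fin d) (m : ℤ) {n : ℤ} (hn : n < 0) {u : Mr d r}
    (hu : u ∈ positivePart d r (vac d r)) :
    ⁅vL r i k m n, u⁆ ∈ positivePart d r (vac d r) := by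
  refine lie_mem_monomialSpan (fun l hl => ?_) hu
  cases l with
  | nil => exact absurd rfl hl
  | cons p l =>
    obtain ⟨⟨b, p⟩, ⟨c, q⟩⟩ := p
    rw [monomial_cons, leibniz_lie]
    refine add_mem ?_ (cre_lie_mem_positivePart _ _ _)
    rw [cre, vL_lie_of_vacExp (by omega)
      (fun _ _ => vacExp_vv_of_neg _ _ _ hn) (by omega)
      (fun _ _ => vacExp_vv_of_neg _ _ _ (by omega)), commL]
    rw [if_neg (c := n + -((p : ℤ) + 1) = 0 ∧ _) (by omega),
      if_neg (c := n + -((q : ℤ) + 1) = 0 ∧ _) (by omega), zero_smul, zero_smul, zero_add,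
      add_zero, add_lie, smul_lie, smul_lie]
    exact add_mem (Submodule.smul_mem _ _ (vL_lie_mem_positivePart_of_neg _ _ hn (by omega) _))
      (Submodule.smul_mem _ _ (vL_lie_mem_positivePart_of_neg _ _ (by omega) hn _))

/-- With `Q` the elements preserving `positivePart` and `Q'` those preserving the image `W'` of `W`,
the set `Q ∪ Q'` spans `𝓛_r`. So the closure of `W'` under `Q` alone is already a submodule, and it
stays in `positivePart` because `W'` does. -/
theorem generated_le_positivePart {i : Fin d} (hi : (i : ℕ) = 0)
    {W : LieSubmodule ℂ (Lone r i) (Mone r i)} (h : W ≠ ⊤) :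
    (generated W).toSubmodule ≤ positivePart d r (vac d r) := by
  let W' : Submodule ℂ (Mr d r) := (imageInMr W).toSubmodule
  have hW'M : ∀ u ∈ W', u ∈ Mone r i := by
    intro u hu
    obtain ⟨w, -, rfl⟩ := mem_imageInMr.mp hu
    exact w.2
  let Q : Set (Lr d r) :=
    {x | ∀ u ∈ positivePart d r (vac d r), ⁅x, u⁆ ∈ positivePart d r (vac d r)}
  let Q' : Set (Lr d r) := {x | ∀ u ∈ W', ⁅x, u⁆ ∈ W'}
  have hkill : ∀ x : Lr d r, (∀ u ∈ Mone r i, ⁅x, u⁆ = 0) → x ∈ Q' := fun x hx u hu => by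
    rw [hx u (hW'M u hu)]; exact zero_mem _
  have hneg : ∀ (j k : Fin d) (m n : ℤ), n < 0 → vL r j k m n ∈ Q :=
    fun j k m n hn u hu => vL_lie_mem_positivePart j k m hn hu
  have hspan : ∀ x : Lr d r, x ∈ Submodule.span ℂ (Q ∪ Q') := by
    refine mem_span_of_forall (Submodule.subset_span (Or.inr fun u hu => ?_))
      (fun j m n hmn => Submodule.subset_span ?_) (fun j k m n hjk => Submodule.subset_span ?_)
    · rwa [unitL_lie_eq]
    · by_cases hj : j = i
      · subst hj
        exact Or.inr fun u hu => (imageInMr W).lie_mem (x := ⟨_, vL_mem_Lone hmn⟩) hu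
      · rcases lt_or_ge n 0 with hn | hn
        · exact Or.inl (hneg _ _ _ _ hn)
        · exact Or.inr (hkill _ fun u hu => vL_lie_Mone_of_ne hj hj (Or.inr hn)
            (vacExp_vv_of_nonneg _ _ _ hn) hu)
    -- The first index is the smallest, so it cannot be the larger index of a mixed product.
    · have hk : k ≠ i := by
        rintro rfl
        have : (j : ℕ) < k := hjk
        omega
      by_cases hj : j = i
      · subst hj
        rcases lt_or_ge n 0 with hn | hn
        · exact Or.inl (hneg _ _ _ _ hn)
        · exact Or.inr (hkill _ fun u hu => vL_lie_Mone_of_nonneg hk m hn hu)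
      · by_cases hmn : 0 ≤ m ∨ 0 ≤ n
        · exact Or.inr (hkill _ fun u hu => vL_lie_Mone_of_ne hj hk hmn
            (vacExp_vv_of_ne hjk.ne _ _) hu)
        · exact Or.inl (hneg _ _ _ _ (by omega))
  let P : LieSubmodule ℂ (Lr d r) (Mr d r) :=
    { stableClosure Q W' with
      -- The condition on commutators is automatic, because `Q ∪ Q'` spans all of `𝓛_r`.
      lie_mem := fun {x u} hu => lie_mem_stableClosure_of_comm (fun x _ y _ => hspan _)
        (fun x hx u hu => hx u hu) (hspan x) hu }
  have hP : generated W ≤ P := by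
    rw [generated, LieSubmodule.lieSpan_le]
    rintro _ ⟨w, hw, rfl⟩
    exact le_stableClosure Q W' (coe_mem_imageInMr.mpr hw)
  exact le_trans (show (generated W).toSubmodule ≤ P.toSubmodule from hP)
    (stableClosure_le (imageInMr_le_positivePart h) fun y hy u hu => hy u hu)

theorem coe_mem_generated {i : Fin d} {W : LieSubmodule ℂ (Lone r i) (Mone r i)} {u : Mone r i}
    (h : u ∈ W) : (u : Mr d r) ∈ generated W :=
  LieSubmodule.subset_lieSpan ⟨u, h, rfl⟩

theorem mem_intersection {i : Fin d} {W : LieSubmodule ℂ (Lr d r) (Mr d r)} {u : Mone r i} :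
    u ∈ intersection i W ↔ (u : Mr d r) ∈ W := Iff.rfl

/-- Every submodule of `M_r` is generated by its intersection with `M_r⁽¹⁾`. -/
theorem le_generated_intersection (i : Fin d) (W : LieSubmodule ℂ (Lr d r) (Mr d r)) :
    W ≤ generated (intersection i W) := by
  -- Induction on the number of modes outside component `i`; with none left, the vector lies in
  -- `M_r⁽¹⁾`.
  have key : ∀ (n : ℕ) (A : Finset (Mode d)), (A.filter fun b => b.1 ≠ i).card = n →
      W.toSubmodule ⊓ monomialSpan r (vac d r) (supported (A : Set (Mode d))) ≤
        (generated (intersection i W)).toSubmodule := by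
    intro n
    induction n with
    | zero =>
      rintro A hA u ⟨huW, hu⟩
      rw [Finset.card_eq_zero, Finset.filter_eq_empty_iff] at hA
      have hu1 : u ∈ Mone r i := mem_Mone_iff.mpr
        (monomialSpan_mono (supported_mono fun b hb => not_not.mp (hA hb)) hu)
      exact coe_mem_generated (u := ⟨u, hu1⟩) (mem_intersection.mpr huW)
    | succ n ih =>
      intro A hA
      obtain ⟨b, hb⟩ := Finset.card_pos.mp (show 0 < (A.filter fun b => b.1 ≠ i).card by omega)
      obtain ⟨hbA, hbi⟩ := Finset.mem_filter.mp hb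
      -- A number unused in every component makes `(i, m)` a fresh mode; trading `b` for it lowers
      -- the count by one.
      obtain ⟨m, hm⟩ := Infinite.exists_notMem_finset (A.image Prod.snd)
      have hbb : ((i, m) : Mode d) ≠ b := fun h => hbi (h ▸ rfl)
      have hA' : ((i, m) : Mode d) ∉ A := fun h => hm (Finset.mem_image_of_mem Prod.snd h)
      refine mem_of_replace_mode isVacuum_vac hbb (Finset.mem_coe.mpr hbA)
        (fun h => hA' (Finset.mem_coe.mp h))
        (fun u hu => W.lie_mem hu) (fun u hu => W.lie_mem hu)
        (fun u hu => LieSubmodule.lie_mem _ hu) ?_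
      have hc : (insert (i, m) (A : Set (Mode d)) \ {b}) =
          (((insert (i, m) A).erase b : Finset (Mode d)) : Set (Mode d)) := by
        push_cast; rfl
      rw [hc]
      refine ih _ ?_
      have hf : ((insert (i, m) A).erase b).filter (fun b => b.1 ≠ i) =
          (A.filter fun b => b.1 ≠ i).erase b := by
        rw [Finset.filter_erase, Finset.filter_insert, if_neg (by simp)]
      rw [hf, Finset.card_erase_of_mem hb, hA, Nat.add_sub_cancel]
  intro u hu
  obtain ⟨S, -, hS⟩ := exists_finset_of_mem (mem_monomialSpan_univ u)
  exact key _ S rfl ⟨hu, hS⟩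

/-! ### Maximal proper submodules -/

/-- A zero vacuum would lie in every submodule and leave no proper one. Thus the nonvanishing of the
vacuum comes from reducibility. -/
theorem vac_ne_zero_of_Mr {W : LieSubmodule ℂ (Lr d r) (Mr d r)} (h : W ≠ ⊤) : vac d r ≠ 0 :=
  fun h0 => h (eq_top_of_vac_mem (h0 ▸ W.zero_mem))

theorem vac_ne_zero_of_Mone {i : Fin d} {W : LieSubmodule ℂ (Lone r i) (Mone r i)} (h : W ≠ ⊤) :
    vac d r ≠ 0 :=
  fun h0 => h (Mone_eq_top_of_vac_mem (h0 ▸ (imageInMr W).zero_mem))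

theorem ne_top_of_le_positivePart {W : LieSubmodule ℂ (Lr d r) (Mr d r)} (h0 : vac d r ≠ 0)
    (h : W.toSubmodule ≤ positivePart d r (vac d r)) : W ≠ ⊤ := by
  rintro rfl
  exact vacuum_notMem_positivePart isVacuum_vac h0 (h Submodule.mem_top)

theorem generated_ne_top {i : Fin d} (hi : (i : ℕ) = 0)
    {W : LieSubmodule ℂ (Lone r i) (Mone r i)} (h : W ≠ ⊤) : generated W ≠ ⊤ :=
  ne_top_of_le_positivePart (vac_ne_zero_of_Mone h) (generated_le_positivePart hi h)

theorem intersection_ne_top {i : Fin d} {W : LieSubmodule ℂ (Lr d r) (Mr d r)} (h : W ≠ ⊤) :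
    intersection i W ≠ ⊤ := by
  intro h1
  have : (⟨vac d r, vac_mem_Mone i⟩ : Mone r i) ∈ intersection i W := h1 ▸ LieSubmodule.mem_top _
  exact h (eq_top_of_vac_mem this)

theorem le_intersection_generated {i : Fin d} (W : LieSubmodule ℂ (Lone r i) (Mone r i)) :
    W ≤ intersection i (generated W) :=
  fun _ hu => coe_mem_generated hu

theorem generated_mono {i : Fin d} {W W' : LieSubmodule ℂ (Lone r i) (Mone r i)} (h : W ≤ W') :
    generated W ≤ generated W' := by
  apply LieSubmodule.lieSpan_mono
  rintro _ ⟨w, hw, rfl⟩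
  exact ⟨w, h hw, rfl⟩

/-- All proper submodules lie in the one subspace `positivePart`, which misses the vacuum; so their
sum is still proper. -/
theorem exists_isMaximalProper_Mr (h0 : vac d r ≠ 0) :
    ∃ W : LieSubmodule ℂ (Lr d r) (Mr d r), IsMaximalProper W := by
  refine ⟨sSup {N | N ≠ ⊤}, ne_top_of_le_positivePart h0 ?_, fun N hN => le_sSup hN⟩
  rw [LieSubmodule.sSup_toSubmodule_eq_iSup]
  exact iSup₂_le fun N hN => proper_le_positivePart hN

/-- A proper `N` is contained in the submodule generated by `N ∩ M_r⁽¹⁾`, and that intersection is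
proper, hence contained in `W`. -/
theorem isMaximalProper_generated {i : Fin d} (hi : (i : ℕ) = 0)
    {W : LieSubmodule ℂ (Lone r i) (Mone r i)} (hW : IsMaximalProper W) :
    IsMaximalProper (generated W) :=
  ⟨generated_ne_top hi hW.1, fun N hN =>
    (le_generated_intersection i N).trans (generated_mono (hW.2 (intersection_ne_top hN)))⟩

theorem isMaximalProper_intersection {i : Fin d} (hi : (i : ℕ) = 0)
    {W : LieSubmodule ℂ (Lr d r) (Mr d r)} (hW : IsMaximalProper W) :
    IsMaximalProper (intersection i W) :=
  ⟨intersection_ne_top hW.1, fun N hN => (le_intersection_generated N).trans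
    fun _ hu => hW.2 (generated_ne_top hi hN) hu⟩

theorem isReducible_iff {i : Fin d} (hi : (i : ℕ) = 0) :
    IsReducible (Lr d r) (Mr d r) ↔ IsReducible (Lone r i) (Mone r i) := by
  constructor
  · rintro ⟨W, hW0, hW1⟩
    refine ⟨intersection i W, fun h => hW0 ?_, intersection_ne_top hW1⟩
    rw [eq_bot_iff]
    refine (le_generated_intersection i W).trans ?_
    rw [h, generated, LieSubmodule.lieSpan_le]
    rintro _ ⟨w, hw, rfl⟩
    rw [(LieSubmodule.mem_bot w).mp hw]
    exact LieSubmodule.zero_mem _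
  · rintro ⟨W, hW0, hW1⟩
    refine ⟨generated W, fun h => hW0 ?_, generated_ne_top hi hW1⟩
    rw [eq_bot_iff]
    intro w hw
    have := coe_mem_generated hw
    rw [h, LieSubmodule.mem_bot] at this
    exact (LieSubmodule.mem_bot w).mpr (Subtype.ext this)

end Generated

end JordanVOA

end

theorem proposition4p6 (d : ℕ) (hd : 2 ≤ d) (r : ℂ) (i₁ : Fin d) (hi₁ : (i₁ : ℕ) = 0) :
    (JordanVOA.IsReducible (JordanVOA.Lr d r) (JordanVOA.Mr d r) ↔
      JordanVOA.IsReducible (JordanVOA.Lone r i₁) (JordanVOA.Mone r i₁)) ∧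
    (JordanVOA.IsReducible (JordanVOA.Lr d r) (JordanVOA.Mr d r) →
      (∃ W₁ : LieSubmodule ℂ (JordanVOA.Lone r i₁) (JordanVOA.Mone r i₁),
        JordanVOA.IsMaximalProper W₁) ∧
      (∃ W₂ : LieSubmodule ℂ (JordanVOA.Lr d r) (JordanVOA.Mr d r),
        JordanVOA.IsMaximalProper W₂) ∧
      (∀ W₁ : LieSubmodule ℂ (JordanVOA.Lone r i₁) (JordanVOA.Mone r i₁),
        JordanVOA.IsMaximalProper W₁ →
          JordanVOA.IsMaximalProper (JordanVOA.generated W₁)) ∧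
      (∀ W₂ : LieSubmodule ℂ (JordanVOA.Lr d r) (JordanVOA.Mr d r),
        JordanVOA.IsMaximalProper W₂ →
          JordanVOA.IsMaximalProper (JordanVOA.intersection i₁ W₂))) := by
  refine ⟨JordanVOA.isReducible_iff hi₁, ?_⟩
  rintro ⟨W, -, hW⟩
  -- Existence is proved only for `M_r`; intersecting gives it for `M_r⁽¹⁾`.
  obtain ⟨W₂, hW₂⟩ := JordanVOA.exists_isMaximalProper_Mr (JordanVOA.vac_ne_zero_of_Mr hW)
  exact ⟨⟨_, JordanVOA.isMaximalProper_intersection hi₁ hW₂⟩, ⟨W₂, hW₂⟩,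
    fun _ h => JordanVOA.isMaximalProper_generated hi₁ h,
    fun _ h => JordanVOA.isMaximalProper_intersection hi₁ h⟩
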